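/- **Setting.** Let $\Gamma$ be a finite connected graph, $f\colon\Gamma\to\Gamma$ a homotopy equivalence that maps vertices to vertices and each edge across a (non-constant) edge-path, and assume that $f$ fixes a vertex $*$. Let $H\subseteq\Gamma$ be a subgraph with $f(H)\subseteq H$. Put $\mathbb F=\pi_1(\Gamma,*)$ and let $\Phi_f\in\mathrm{Aut}(\mathbb F)$ be the automorphism induced by $f$. Let $\widetilde\Gamma$ be the universal cover, $\widetilde H\subseteq\widetilde\Gamma$ the preimage of $H$, $\tilde f$ the lift of $f$ that fixes a chosen lift of $*$, and $A_f$ the map induced by $\tilde f$ on $C_1(\widetilde\Gamma;\mathbb Q)$, so that $A_f(gx)=\Phi_f(g)A_f(x)$ for $g\in\mathbb F$. Let $C_1(\widetilde\Gamma,\widetilde H;\mathbb Q)$ be the $\mathbb Q[\mathbb F]$-module of the rational 1-chains $x=\sum_e x_e e$ with $x_e=0$ for all edges $e$ of $\widetilde H$, let $\pi_H^\perp$ be the projection of $C_1(\widetilde\Gamma;\mathbb Q)$ onto it that deletes the coefficients on $\widetilde H$, and let $A=A_{f,H}=\pi_H^\perp\circ A_f$ on $C_1(\widetilde\Gamma,\widetilde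 H;\mathbb Q)$. Use $\langle x,x'\rangle=\sum_e x_ex'_e$, $\|x\|^2=\langle x,x\rangle$ and $\operatorname{supp}(x)=\{e: x_e\ne0\}$. For distinct vertices $u,v$ of $\widetilde\Gamma$ let $[u,v]$ be the 1-chain with $\partial[u,v]=v-u$. **Nielsen 1-chains.** A *Nielsen 1-chain* is a chain $\rho=\pi_H^\perp([u,v])$ with $u\neq v$, $\tilde f(u)=u$, $\tilde f(v)=v$, such that one of the following holds. * (non-geometric) There is an edge $e$ of $\widetilde\Gamma$ not in $\widetilde H$ with $\rho_e=\pm1$ and $\rho_{ge}=0$ for all $g\in\mathbb F\setminus\{1\}$. * (geometric) (i) For distinct $g_1,g_2\in\mathbb F$, $\operatorname{supp}(g_1\rho)\cap\operatorname{supp}(g_2\rho)$ is empty or a single edge; (ii) for every edge $e$ of $\widetilde\Gamma$ not in $\widetilde H$ there is exactly one unordered pair of distinct elements $g_1,g_2\in\mathbb F$ with $\operatorname{supp}(g_1\rho)\cap\operatorname{supp}(g_2\rho)=\{e\}$; (iii) there are non-commuting $g_1,g_2\in\mathbb F$ such that $\operatorname{supp}(\rho)\cap\operatorname{supp}(g_i\rho)\neq\emptyset$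 for $i=1,2$. **Chain flare condition.** For a $\mathbb Q[\mathbb F]$-submodule $V$ and $0<\theta<1$ let $N_\theta(V)=\{x'\in C_1(\widetilde\Gamma,\widetilde H;\mathbb Q) : \langle x,x'\rangle>\theta\|x\|\|x'\|\text{ for some }x\in V\}$. For a set $N$ let $N^\infty$ be the set of all relative 1-chains $x'$ such that, for some $k\ge0$, $x'\in A^k(N)$ or $A^k(x')\in N$. Assume that $f$ satisfies the chain flare condition relative to $H$, with $\mathbb Q[\mathbb F]$-submodules $V_{\rm h},V_{\rm qf}\subseteq C_1(\widetilde\Gamma,\widetilde H;\mathbb Q)$. That is: 1. $C_1(\widetilde\Gamma,\widetilde H;\mathbb Q)=V_{\rm h}+V_{\rm qf}$; 2. there are $\lambda_0>1$ and $0<\theta<1$ with $\lambda_0\|A(x)\|\le\max\{\|A^2(x)\|,\|x\|\}$ for all $x\in N_\theta(V_{\rm h})^\infty$; 3. if $V_{\rm qf}\ne\{0\}$, there is a Nielsen 1-chain $\rho$ such that every $x\in V_{\rm qf}$ is a finite rational linear combination of translates $g\rho$, $g\in\mathbb F$. **The operator and the subspaces.** Let $G_\phi=\mathbb F\rtimes_{\Phi_f}\langle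 t\rangle=\langle\mathbb F,t\mid t^{-1}xt=\Phi_f(x)\ (x\in\mathbb F)\rangle$ and let $n_H$ be the number of edges of $\Gamma$ not in $H$. Choose a lift to $\widetilde\Gamma$ of each of these edges; these lifts form a basis of the free $\mathbb Q[\mathbb F]$-module $C_1(\widetilde\Gamma,\widetilde H;\mathbb Q)\cong\mathbb Q[\mathbb F]^{n_H}$. Let $J$ be the $n_H\times n_H$ matrix over the group ring of $\mathbb F$ whose rows are the coordinates of $A_{f,H}$ of the basis elements, and let $L_{f,H}$ be the bounded operator on $L^2(G_\phi)^{n_H}$ given by right multiplication by $tJ$. Let $V_{\rm qf}^{(2)}\subseteq L^2(\mathbb F)^{n_H}\subseteq L^2(G_\phi)^{n_H}$ be the closed complex span of $V_{\rm qf}$, and let $W_{\rm qf}^{(2)}$ be the closure of $\bigoplus_{\ell\in\mathbb Z}t^\ell V_{\rm qf}^{(2)}$ in $L^2(G_\phi)^{n_H}$. For a bounded operator $B$ on a Hilbert space $\mathcal H$ and $\nu>0$ let $$\mathfrak E(B,\nu)=\{\xi\in\mathcal H:\exists(\xi_j)\subset\mathcal H,\ \lim_{j\to\infty}\|\xi_j-\xi\|=0,\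 \limsup_{j\to\infty}\|B^j\xi_j\|^{1/j}\le\nu\},$$ $$\mathfrak F(B,\nu)=\{\xi\in\mathcal H:\exists(\xi_j)\subset\mathcal H,\ \lim_{j\to\infty}\|B^j\xi_j-\xi\|=0,\ \limsup_{j\to\infty}\|\xi_j\|^{1/j}\le\nu^{-1}\}.$$ **Theorem.** There is a constant $\lambda>1$ such that for every $1\le\nu<\lambda$ $$W_{\rm qf}^{(2)}=\mathfrak E(L_{f,H},\nu)\cap\mathfrak F(L_{f,H},\nu^{-1}).$$ -/

import Mathlib

open CategoryTheory Filter Topology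
open scoped ENNReal

universe u v

noncomputable section

namespace ChainFlare

/-! ### Graphs, cellular maps, homotopy equivalences

A graph is a quiver `V`: its points are the vertices and its arrows are the (oriented) edges.
Edge-paths may cross edges in both directions.
The fundamental groupoid of the graph is `Quiver.FreeGroupoid V`: its morphisms are the edge-paths
modulo insertion and deletion of backtracking, that is, modulo homotopy relative to endpoints. -/

section Graphs

variable (V : Type u) [Quiver.{v} V]

variable {V} in
/-- Edge-paths (possibly constant) from one vertex to another; the last edge is crossed either in its
own direction (`pos`) or in the opposite direction (`neg`). -/
inductive EdgePath : V → V → Type (max u v)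
  | nil (a : V) : EdgePath a a
  | pos {a b c : V} (p : EdgePath a b) (e : b ⟶ c) : EdgePath a c
  | neg {a b c : V} (p : EdgePath a b) (e : c ⟶ b) : EdgePath a c

/-- The graph is connected. -/
def IsConnectedGraph : Prop := ∀ a b : V, Nonempty (EdgePath a b)

variable {V}

/-- A vertex, as an object of the fundamental groupoid. -/
abbrev pt (a : V) : Quiver.FreeGroupoid V := (Quiver.FreeGroupoid.of V).obj a

/-- The homotopy class (rel endpoints) of an edge. -/
abbrev edgeClass {a b : V} (e : a ⟶ b) : pt a ⟶ pt b := (Quiver.FreeGroupoid.of V).map e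

/-- The homotopy class (rel endpoints) of an edge-path. -/
def EdgePath.homotopyClass {a : V} : {b : V} → EdgePath a b → (pt a ⟶ pt b)
  | _, .nil _ => 𝟙 _
  | _, .pos p e => EdgePath.homotopyClass p ≫ edgeClass e
  | _, .neg p e => EdgePath.homotopyClass p ≫ Groupoid.inv (edgeClass e)

/-- The number of edges of an edge-path. -/
def EdgePath.length {a : V} : {b : V} → EdgePath a b → ℕ
  | _, .nil _ => 0
  | _, .pos p _ => EdgePath.length p + 1
  | _, .neg p _ => EdgePath.length p + 1

/-- The edges (without their direction) crossed by an edge-path. -/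
def EdgePath.crossed {a : V} : {b : V} → EdgePath a b → Set (Quiver.Total V)
  | _, .nil _ => ∅
  | _, .pos p e => insert ⟨_, _, e⟩ (EdgePath.crossed p)
  | _, .neg p e => insert ⟨_, _, e⟩ (EdgePath.crossed p)

variable (V) in
/-- A cellular self-map of the graph: it maps vertices to vertices and each edge across an
edge-path, which may be constant. -/
structure CellularMap where
  vert : V → V
  path : {a b : V} → (a ⟶ b) → EdgePath (vert a) (vert b)

/-- The functor induced by a cellular map on the fundamental groupoid. -/
def CellularMap.functor (f : CellularMap V) : Quiver.FreeGroupoid V ⥤ Quiver.FreeGroupoid V :=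
  Quiver.FreeGroupoid.lift
    { obj := fun a => pt (f.vert a)
      map := fun e => (f.path e).homotopyClass }

/-- `f` is a homotopy equivalence: it has a homotopy inverse `g`, which is taken cellular.
A homotopy from `g ∘ f` to the identity is given by its tracks at the vertices: edge-paths
(up to homotopy rel endpoints) from `g (f a)` to `a`, such that the square over each edge can be
filled in; this is a natural isomorphism between the functors on the fundamental groupoid. -/
def CellularMap.IsHomotopyEquiv (f : CellularMap V) : Prop :=
  ∃ g : CellularMap V,
    Nonempty (f.functor ⋙ g.functor ≅ 𝟭 _) ∧ Nonempty (g.functor ⋙ f.functor ≅ 𝟭 _)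

variable (V) in
/-- A morphism `f : Γ → Γ` (each edge is expanded across a non-constant edge-path) which is a
homotopy equivalence and fixes a vertex `base`. -/
structure BasedHomotopyEquiv extends CellularMap V where
  length_pos : ∀ {a b : V} (e : a ⟶ b), 0 < (path e).length
  isHomotopyEquiv : toCellularMap.IsHomotopyEquiv
  base : V
  vert_base : vert base = base

variable (V) in
/-- A subgraph: a set of vertices and a set of edges that contains the endpoints of its edges. -/
structure Subgraph where
  verts : Set V
  edges : Set (Quiver.Total V)
  left_mem : ∀ e ∈ edges, e.left ∈ verts
  right_mem : ∀ e ∈ edges, e.right ∈ verts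

/-- `f(H) ⊆ H`. -/
def Subgraph.Invariant (H : Subgraph V) (f : CellularMap V) : Prop :=
  (∀ a ∈ H.verts, f.vert a ∈ H.verts) ∧
    ∀ e ∈ H.edges, (f.path e.hom).crossed ⊆ H.edges

/-- The edges of `Γ - H`. -/
abbrev Subgraph.CoEdge (H : Subgraph V) := {e : Quiver.Total V // e ∉ H.edges}

instance Subgraph.fintypeCoEdge [Finite (Quiver.Total V)] (H : Subgraph V) :
    Fintype H.CoEdge := Fintype.ofFinite _

end Graphs

/-! ### The fundamental group, the universal cover and the lift of `f` -/

section Cover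

variable {V : Type u} [Quiver.{v} V]

/-- The fundamental group `𝔽 = π₁(Γ, x₀)`; the product is concatenation of loops. -/
abbrev Pi1 (x₀ : V) := pt x₀ ⟶ pt x₀

/-- The vertices of the universal cover: homotopy classes of edge-paths in `Γ` that start at the
base vertex. The lift of the base vertex is the class of the constant path. -/
abbrev CoverVertex (x₀ : V) := Σ a : V, (pt x₀ ⟶ pt a)

/-- The edges of the universal cover: an edge `e` of `Γ` with a lift of its initial vertex. -/
abbrev CoverEdge (x₀ : V) := Σ e : Quiver.Total V, (pt x₀ ⟶ pt e.left)

/-- Initial vertex of an edge of the universal cover. -/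
def CoverEdge.o {x₀ : V} (e : CoverEdge x₀) : CoverVertex x₀ := ⟨e.1.left, e.2⟩

/-- Terminal vertex of an edge of the universal cover. -/
def CoverEdge.t {x₀ : V} (e : CoverEdge x₀) : CoverVertex x₀ :=
  ⟨e.1.right, e.2 ≫ edgeClass e.1.hom⟩

/-- The action of `𝔽` on the edges of the universal cover. -/
def CoverEdge.act {x₀ : V} (g : Pi1 x₀) (e : CoverEdge x₀) : CoverEdge x₀ := ⟨e.1, g ≫ e.2⟩

theorem CoverEdge.act_injective {x₀ : V} (g : Pi1 x₀) : Function.Injective (CoverEdge.act g) := by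
  rintro ⟨e, p⟩ ⟨e', p'⟩ h
  obtain ⟨rfl, h⟩ := Sigma.mk.inj_iff.1 h
  exact Sigma.ext rfl (heq_of_eq ((cancel_epi g).1 (eq_of_heq h)))

theorem CoverEdge.act_left_injective {x₀ : V} (e : CoverEdge x₀) :
    Function.Injective fun g : Pi1 x₀ => e.act g := by
  intro g k h
  exact (cancel_mono e.2).1 (eq_of_heq (Sigma.mk.inj_iff.1 h).2)

/-- The image of a morphism from `c` under a functor that fixes `c`. -/
def basedMap {C : Type*} [Groupoid C] (F : C ⥤ C) {c d : C} (h : F.obj c = c) (p : c ⟶ d) :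
    c ⟶ F.obj d :=
  eqToHom h.symm ≫ F.map p

/-- The endomorphism of the group of loops at `c` induced by a functor that fixes `c`. -/
def loopHom {C : Type*} [Groupoid C] (F : C ⥤ C) {c : C} (h : F.obj c = c) : (c ⟶ c) →* (c ⟶ c) where
  toFun g := eqToHom h.symm ≫ F.map g ≫ eqToHom h
  map_one' := by
    change eqToHom h.symm ≫ F.map (𝟙 c) ≫ eqToHom h = 𝟙 c
    simp
  map_mul' g k := by
    change eqToHom h.symm ≫ F.map (g ≫ k) ≫ eqToHom h =
      (eqToHom h.symm ≫ F.map g ≫ eqToHom h) ≫ eqToHom h.symm ≫ F.map k ≫ eqToHom h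
    simp

theorem loopHom_bijective {C : Type*} [Groupoid C] {F : C ⥤ C} (hF : F.FullyFaithful) {c : C}
    (h : F.obj c = c) : Function.Bijective (loopHom F h) := by
  constructor
  · intro g k hgk
    change eqToHom h.symm ≫ F.map g ≫ eqToHom h = eqToHom h.symm ≫ F.map k ≫ eqToHom h at hgk
    exact hF.map_injective ((cancel_mono (eqToHom h)).1 ((cancel_epi (eqToHom h.symm)).1 hgk))
  · intro g
    refine ⟨hF.preimage (eqToHom h ≫ g ≫ eqToHom h.symm), ?_⟩
    change eqToHom h.symm ≫ F.map _ ≫ eqToHom h = g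
    simp

namespace BasedHomotopyEquiv

variable (f : BasedHomotopyEquiv V)

/-- The image under `f` of the homotopy class of an edge-path that starts at the base vertex. -/
def onClass {a : V} (p : pt f.base ⟶ pt a) : pt f.base ⟶ pt (f.vert a) :=
  basedMap f.functor (congrArg pt f.vert_base) p

/-- The endomorphism `g ↦ f(g)` of the group of loops at the base vertex. -/
def PhiHom : Pi1 f.base →* Pi1 f.base :=
  loopHom f.functor (congrArg pt f.vert_base)

theorem PhiHom_bijective : Function.Bijective f.PhiHom := by
  obtain ⟨g, ⟨i⟩, ⟨j⟩⟩ := f.isHomotopyEquiv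
  exact loopHom_bijective (CategoryTheory.Equivalence.mk f.functor g.functor i.symm j).fullyFaithfulFunctor _

/-- The automorphism `Φ_f` of `𝔽` induced by `f` and the constant path at the base vertex. -/
def Phi : MulAut (Pi1 f.base) := MulEquiv.ofBijective f.PhiHom f.PhiHom_bijective

/-- The lift `f̃` of `f` that fixes the lift of the base vertex, on vertices. -/
def liftVertex (u : CoverVertex f.base) : CoverVertex f.base := ⟨f.vert u.1, f.onClass u.2⟩

end BasedHomotopyEquiv

end Cover

/-! ### Chains in the universal cover -/

section Chains

variable {V : Type u} [Quiver.{v} V]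

/-- Rational cellular 1-chains of the universal cover. -/
abbrev Chain₁ (x₀ : V) := CoverEdge x₀ →₀ ℚ

/-- Rational cellular 0-chains of the universal cover. -/
abbrev Chain₀ (x₀ : V) := CoverVertex x₀ →₀ ℚ

/-- The boundary map, `∂ e = t(e) - o(e)`. -/
def boundary (x₀ : V) : Chain₁ x₀ →ₗ[ℚ] Chain₀ x₀ :=
  Finsupp.linearCombination ℚ fun e => Finsupp.single e.t 1 - Finsupp.single e.o 1

/-- The action of `g ∈ 𝔽` on 1-chains. -/
def chainAct {x₀ : V} (g : Pi1 x₀) : Chain₁ x₀ →ₗ[ℚ] Chain₁ x₀ :=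
  Finsupp.lmapDomain ℚ ℚ (CoverEdge.act g)

/-- The 1-chain of the lift, with initial vertex `p`, of an edge-path of `Γ`. -/
def EdgePath.liftChain {x₀ a : V} (p : pt x₀ ⟶ pt a) : {b : V} → EdgePath a b → Chain₁ x₀
  | _, .nil _ => 0
  | _, .pos q e =>
      EdgePath.liftChain p q + Finsupp.single ⟨⟨_, _, e⟩, p ≫ EdgePath.homotopyClass q⟩ 1
  | _, .neg q e =>
      EdgePath.liftChain p q - Finsupp.single
        ⟨⟨_, _, e⟩, p ≫ EdgePath.homotopyClass q ≫ Groupoid.inv (edgeClass e)⟩ 1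

/-- The relative 1-chains `C₁(Γ̃, H̃; ℚ)`: the coefficients at the edges of `H̃` vanish. -/
def relChain (x₀ : V) (H : Subgraph V) : Submodule ℚ (Chain₁ x₀) where
  carrier := {x | ∀ e : CoverEdge x₀, e.1 ∈ H.edges → x e = 0}
  zero_mem' := fun _ _ => rfl
  add_mem' := fun {x y} hx hy e he => by
    rw [Finsupp.add_apply, hx e he, hy e he, add_zero]
  smul_mem' := fun c x hx e he => by
    rw [Finsupp.smul_apply, hx e he, smul_zero]

open Classical in
/-- The projection `π_H^⊥` of the 1-chains onto the relative 1-chains: the coefficients at the edges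
of `H̃` are replaced by zero. -/
def projRel (x₀ : V) (H : Subgraph V) : Chain₁ x₀ →ₗ[ℚ] relChain x₀ H where
  toFun x := ⟨x.filter fun e => e.1 ∉ H.edges, fun _ he =>
    Finsupp.filter_apply_neg _ _ (not_not.mpr he)⟩
  map_add' _ _ := Subtype.ext Finsupp.filter_add
  map_smul' _ _ := Subtype.ext Finsupp.filter_smul

theorem chainAct_mem_relChain {x₀ : V} (H : Subgraph V) (g : Pi1 x₀) {x : Chain₁ x₀}
    (hx : x ∈ relChain x₀ H) : chainAct g x ∈ relChain x₀ H := by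
  intro e he
  have h : e = CoverEdge.act g ⟨e.1, Groupoid.inv g ≫ e.2⟩ :=
    Sigma.ext rfl (heq_of_eq (by
      change e.2 = g ≫ Groupoid.inv g ≫ e.2
      rw [← Category.assoc, Groupoid.comp_inv, Category.id_comp]))
  rw [h]
  exact (Finsupp.mapDomain_apply (CoverEdge.act_injective g) x _).trans (hx _ he)

/-- The action of `g ∈ 𝔽` on relative 1-chains. -/
def relAct {x₀ : V} (H : Subgraph V) (g : Pi1 x₀) : relChain x₀ H →ₗ[ℚ] relChain x₀ H :=
  (chainAct g).restrict fun _ hx => chainAct_mem_relChain H g hx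

/-- The rational subspace `W` of the relative 1-chains is a `ℚ[𝔽]`-submodule. -/
def IsPi1Stable {x₀ : V} {H : Subgraph V} (W : Submodule ℚ (relChain x₀ H)) : Prop :=
  ∀ g : Pi1 x₀, ∀ x ∈ W, relAct H g x ∈ W

/-- The inner product `∑ x_e y_e` of 1-chains. -/
def chainInner {x₀ : V} (x y : Chain₁ x₀) : ℝ := x.sum fun e a => (a : ℝ) * (y e : ℝ)

/-- The `L²`-norm of a 1-chain. -/
def chainNorm {x₀ : V} (x : Chain₁ x₀) : ℝ := Real.sqrt (chainInner x x)

namespace BasedHomotopyEquiv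

variable (f : BasedHomotopyEquiv V) (H : Subgraph V)

/-- The map `A_f` induced by `f̃` on 1-chains: the edge of the universal cover over `e` with initial
vertex `p` is mapped to the chain of the lift of `f(e)` with initial vertex `f̃(p)`. -/
def A : Chain₁ f.base →ₗ[ℚ] Chain₁ f.base :=
  Finsupp.linearCombination ℚ fun e => EdgePath.liftChain (f.onClass e.2) (f.path e.1.hom)

/-- The map `A_{f,H}` on relative 1-chains. -/
def ARel : relChain f.base H →ₗ[ℚ] relChain f.base H :=
  projRel f.base H ∘ₗ f.A ∘ₗ (relChain f.base H).subtype

/-- The set of edges in the support of `g ρ`. -/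
def suppAct (g : Pi1 f.base) (ρ : Chain₁ f.base) : Set (CoverEdge f.base) :=
  ((chainAct g ρ).support : Set (CoverEdge f.base))

/-- `ρ = π_H^⊥([u, v])` for distinct vertices `u`, `v` that are fixed by `f̃`, where `[u, v]` is the
1-chain with boundary `v - u`. -/
def IsFixedSegment (ρ : relChain f.base H) : Prop :=
  ∃ u v : CoverVertex f.base, u ≠ v ∧ f.liftVertex u = u ∧ f.liftVertex v = v ∧
    ∃ c : Chain₁ f.base,
      boundary f.base c = Finsupp.single v 1 - Finsupp.single u 1 ∧ ρ = projRel f.base H c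

/-- The condition that makes `ρ` non-geometric. -/
def NonGeometric (ρ : Chain₁ f.base) : Prop :=
  ∃ e : CoverEdge f.base, e.1 ∉ H.edges ∧ (ρ e = 1 ∨ ρ e = -1) ∧
    ∀ g : Pi1 f.base, g ≠ 1 → ρ (e.act g) = 0

/-- The conditions that make `ρ` geometric. -/
structure Geometric (ρ : Chain₁ f.base) : Prop where
  single : ∀ g₁ g₂ : Pi1 f.base, g₁ ≠ g₂ →
    f.suppAct g₁ ρ ∩ f.suppAct g₂ ρ = ∅ ∨ ∃ e, f.suppAct g₁ ρ ∩ f.suppAct g₂ ρ = {e}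
  pair : ∀ e : CoverEdge f.base, e.1 ∉ H.edges →
    ∃ g₁ g₂ : Pi1 f.base, g₁ ≠ g₂ ∧ f.suppAct g₁ ρ ∩ f.suppAct g₂ ρ = {e} ∧
      ∀ h₁ h₂ : Pi1 f.base, h₁ ≠ h₂ → f.suppAct h₁ ρ ∩ f.suppAct h₂ ρ = {e} →
        (h₁ = g₁ ∧ h₂ = g₂) ∨ (h₁ = g₂ ∧ h₂ = g₁)
  noncommuting : ∃ g₁ g₂ : Pi1 f.base, g₁ * g₂ ≠ g₂ * g₁ ∧
    (f.suppAct 1 ρ ∩ f.suppAct g₁ ρ).Nonempty ∧ (f.suppAct 1 ρ ∩ f.suppAct g₂ ρ).Nonempty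

/-- Nielsen 1-chains. -/
def IsNielsen (ρ : relChain f.base H) : Prop :=
  f.IsFixedSegment H ρ ∧ (f.NonGeometric H ρ ∨ f.Geometric H ρ)

/-- The chains that make a small angle with an element of `W`. -/
def angleNhd {x₀ : V} {H : Subgraph V} (θ : ℝ) (W : Submodule ℚ (relChain x₀ H)) :
    Set (relChain x₀ H) :=
  {x' | ∃ x ∈ W, θ * chainNorm (x : Chain₁ x₀) * chainNorm (x' : Chain₁ x₀) <
    chainInner (x : Chain₁ x₀) (x' : Chain₁ x₀)}

/-- `N^∞`, the union of the images and of the preimages of `N` under the iterates of `A_{f,H}`. -/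
def saturate (N : Set (relChain f.base H)) : Set (relChain f.base H) :=
  {x' | ∃ k : ℕ, (∃ x ∈ N, x' = (f.ARel H ^ k) x) ∨ (f.ARel H ^ k) x' ∈ N}

/-- `f` satisfies the chain flare condition relative to `H`, with hyperbolic submodule `Vh` and
quasi-fixed submodule `Vqf`. -/
structure ChainFlareCondition (Vh Vqf : Submodule ℚ (relChain f.base H)) : Prop where
  stable_h : IsPi1Stable Vh
  stable_qf : IsPi1Stable Vqf
  sup_eq_top : Vh ⊔ Vqf = ⊤
  flare : ∃ lam θ : ℝ, 1 < lam ∧ 0 < θ ∧ θ < 1 ∧ ∀ x ∈ f.saturate H (angleNhd θ Vh),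
    lam * chainNorm (f.ARel H x : Chain₁ f.base) ≤
      max (chainNorm (f.ARel H (f.ARel H x) : Chain₁ f.base)) (chainNorm (x : Chain₁ f.base))
  generated : Vqf ≠ ⊥ → ∃ ρ : relChain f.base H, f.IsNielsen H ρ ∧
    ∀ x ∈ Vqf, ∃ q : Pi1 f.base →₀ ℚ, x = q.sum fun g c => c • relAct H g ρ

end BasedHomotopyEquiv

end Chains

/-! ### `L²` of a group -/

section L2

open scoped lp

/-- `L²(G)`. -/
abbrev L2 (G : Type*) := ℓ²(G, ℂ)

/-- `L²(G)^n` with coordinates indexed by `n`. -/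
abbrev L2n (n G : Type*) [Fintype n] := PiLp 2 fun _ : n => L2 G

theorem norm_extend_rpow {α β : Type*} (i : α ↪ β) (ξ : α → ℂ) (b : β) (hb : b ∉ Set.range i) :
    ‖Function.extend i ξ 0 b‖ ^ (2 : ℝ≥0∞).toReal = 0 := by
  rw [Function.extend_apply' _ _ _ hb]
  simp

theorem memℓp_extend {α β : Type*} (i : α ↪ β) {ξ : α → ℂ} (hξ : Memℓp ξ 2) :
    Memℓp (Function.extend i ξ 0 : β → ℂ) 2 := by
  refine memℓp_gen ((i.injective.summable_iff fun b hb => norm_extend_rpow i ξ b hb).1 ?_)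
  refine (hξ.summable (by norm_num)).congr fun a => ?_
  simp [i.injective.extend_apply]

/-- The isometric embedding `∑ ξ_a a ↦ ∑ ξ_a i(a)` of `L²(α)` into `L²(β)` induced by an injective
map `i : α → β`. -/
def l2Map {α β : Type*} (i : α ↪ β) : L2 α →ₗᵢ[ℂ] L2 β where
  toFun ξ := ⟨Function.extend i ξ 0, memℓp_extend i ξ.2⟩
  map_add' ξ η := by
    refine lp.ext (funext fun b => ?_)
    by_cases hb : ∃ a, i a = b
    · obtain ⟨a, rfl⟩ := hb
      change Function.extend i (ξ + η : α → ℂ) 0 (i a) =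
        Function.extend i ξ 0 (i a) + Function.extend i η 0 (i a)
      simp only [i.injective.extend_apply, Pi.add_apply]
    · change Function.extend i (ξ + η : α → ℂ) 0 b =
        Function.extend i ξ 0 b + Function.extend i η 0 b
      simp only [Function.extend_apply' _ _ _ hb, Pi.zero_apply, add_zero]
  map_smul' c ξ := by
    refine lp.ext (funext fun b => ?_)
    by_cases hb : ∃ a, i a = b
    · obtain ⟨a, rfl⟩ := hb
      simp [i.injective.extend_apply]
    · simp [Function.extend_apply' _ _ _ hb]
  norm_map' ξ := by
    rw [lp.norm_eq_tsum_rpow (by norm_num), lp.norm_eq_tsum_rpow (by norm_num)]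
    congr 1
    have h : Function.support (fun b => ‖Function.extend i ξ 0 b‖ ^ (2 : ℝ≥0∞).toReal) ⊆
        Set.range i := fun b hb => by
      by_contra hb'
      exact hb (norm_extend_rpow i (ξ : α → ℂ) b hb')
    refine (i.injective.tsum_eq h).symm.trans (tsum_congr fun a => ?_)
    rw [i.injective.extend_apply]

/-- `l2Map i` in each coordinate. -/
def l2nMap (n : Type*) [Fintype n] {α β : Type*} (i : α ↪ β) : L2n n α →L[ℂ] L2n n β :=
  (PiLp.continuousLinearEquiv 2 ℂ fun _ : n => L2 β).symm.toContinuousLinearMap ∘L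
    ContinuousLinearMap.pi fun j =>
      (l2Map i).toContinuousLinearMap ∘L PiLp.proj 2 (fun _ : n => L2 α) j

/-- Right multiplication `ξ ↦ ξ · x` by an element `x` of the group algebra, on `L²(G)`. -/
def rightMul {G : Type*} [Group G] (x : MonoidAlgebra ℂ G) : L2 G →L[ℂ] L2 G :=
  x.coeff.sum fun g c => c • (l2Map (mulRightEmbedding g)).toContinuousLinearMap

/-- Right multiplication of row vectors by a matrix over the group algebra, on `L²(G)^n`. -/
def rightMulMatrix {n G : Type*} [Fintype n] [Group G] (M : Matrix n n (MonoidAlgebra ℂ G)) :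
    L2n n G →L[ℂ] L2n n G :=
  (PiLp.continuousLinearEquiv 2 ℂ fun _ : n => L2 G).symm.toContinuousLinearMap ∘L
    ContinuousLinearMap.pi fun j =>
      ∑ i, rightMul (M i j) ∘L PiLp.proj 2 (fun _ : n => L2 G) i

end L2

/-! ### Haagerup–Schultz subspaces

The `limsup`s are taken in `[0, ∞]`. -/

section HaagerupSchultz

variable {E : Type*} [NormedAddCommGroup E] [NormedSpace ℂ E]

/-- The subspace `𝔈(A, ν)`. -/
def hsE (A : E →L[ℂ] E) (ν : ℝ) : Set E :=
  {ξ | ∃ s : ℕ → E, Tendsto (fun j => ‖s j - ξ‖) atTop (𝓝 0) ∧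
    limsup (fun j : ℕ => ‖(A ^ j) (s j)‖ₑ ^ (1 / (j : ℝ))) atTop ≤ ENNReal.ofReal ν}

/-- The subspace `𝔉(A, ν)`. -/
def hsF (A : E →L[ℂ] E) (ν : ℝ) : Set E :=
  {ξ | ∃ s : ℕ → E, Tendsto (fun j => ‖(A ^ j) (s j) - ξ‖) atTop (𝓝 0) ∧
    limsup (fun j : ℕ => ‖s j‖ₑ ^ (1 / (j : ℝ))) atTop ≤ ENNReal.ofReal ν⁻¹}

end HaagerupSchultz

/-! ### The free-by-cyclic group, the operator `L_{f,H}` and the induced quasi-fixed subspace -/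

namespace BasedHomotopyEquiv

variable {V : Type u} [Quiver.{v} V] (f : BasedHomotopyEquiv V)

/-- The free-by-cyclic group `G_φ = 𝔽 ⋊ ⟨t⟩ = ⟨𝔽, t ∣ t⁻¹ x t = Φ_f(x)⟩`. -/
abbrev FreeByCyclic :=
  Pi1 f.base ⋊[zpowersHom (MulAut (Pi1 f.base)) f.Phi⁻¹] Multiplicative ℤ

/-- The stable letter `t`. -/
def t : f.FreeByCyclic := SemidirectProduct.inr (Multiplicative.ofAdd 1)

/-- The inclusion of `𝔽`. -/
def incl : Pi1 f.base →* f.FreeByCyclic := SemidirectProduct.inl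

/-- Conjugation by the stable letter induces `Φ_f`. -/
theorem t_inv_mul_incl_mul_t (x : Pi1 f.base) : f.t⁻¹ * f.incl x * f.t = f.incl (f.Phi x) := by
  have h : f.t * f.incl (f.Phi x) * f.t⁻¹ = f.incl x := by
    have h' := SemidirectProduct.inl_aut (φ := zpowersHom (MulAut (Pi1 f.base)) f.Phi⁻¹)
      (Multiplicative.ofAdd 1) (f.Phi x)
    change _ = SemidirectProduct.inr _ * SemidirectProduct.inl _ * SemidirectProduct.inr _ at h'
    change SemidirectProduct.inr _ * SemidirectProduct.inl _ * (SemidirectProduct.inr _)⁻¹ = _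
    rw [← MonoidHom.map_inv]
    refine h'.symm.trans (congrArg (fun y => SemidirectProduct.inl y) ?_)
    simp
  rw [← h]
  group

variable (H : Subgraph V)

/-- A basis of the `ℚ[𝔽]`-module `C₁(Γ̃, H̃; ℚ)`: a lift of each edge of `Γ - H`, given by a lift of
its initial vertex. -/
abbrev EdgeLifts := (e : H.CoEdge) → (pt f.base ⟶ pt e.1.left)

variable {H}

/-- The chosen lift of an edge of `Γ - H`. -/
def EdgeLifts.edge {f : BasedHomotopyEquiv V} {H : Subgraph V} (b : f.EdgeLifts H) (e : H.CoEdge) :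
    CoverEdge f.base := ⟨e.1, b e⟩

/-- The coordinate in `ℚ[𝔽]` of a 1-chain at the basis element `e`: the coefficient at `g ∈ 𝔽` is the
coefficient of the chain at the edge `g e`. -/
def EdgeLifts.coord {f : BasedHomotopyEquiv V} {H : Subgraph V} (b : f.EdgeLifts H)
    (x : Chain₁ f.base) (e : H.CoEdge) : Pi1 f.base →₀ ℚ :=
  x.comapDomain (fun g => (b.edge e).act g) ((b.edge e).act_left_injective.injOn)

variable [Finite (Quiver.Total V)]

/-- The matrix `t J₁(f)_H` over the group ring of `G_φ`: the row at `e` records the coordinates of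
`A_f(e)`. -/
def tJacobian (b : f.EdgeLifts H) : Matrix H.CoEdge H.CoEdge (MonoidAlgebra ℂ f.FreeByCyclic) :=
  fun e e' => (b.coord (f.A (Finsupp.single (b.edge e) 1)) e').sum fun g q =>
    MonoidAlgebra.single (f.t * f.incl g) (q : ℂ)

/-- The operator `L_{f,H}` on `L²(G_φ)^{n_H}`, right multiplication by `t J₁(f)_H`. -/
def L (b : f.EdgeLifts H) : L2n H.CoEdge f.FreeByCyclic →L[ℂ] L2n H.CoEdge f.FreeByCyclic :=
  rightMulMatrix (f.tJacobian b)

/-- A relative 1-chain as an element of `L²(𝔽)^{n_H}`. -/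
def EdgeLifts.toL2 {f : BasedHomotopyEquiv V} {H : Subgraph V} (b : f.EdgeLifts H)
    (x : Chain₁ f.base) : L2n H.CoEdge (Pi1 f.base) :=
  WithLp.toLp 2 fun e => ⟨fun g => ((b.coord x e g : ℚ) : ℂ),
    (memℓp_zero ((b.coord x e).hasFiniteSupport.subset fun g hg h =>
      hg (by simp [h]))).of_exponent_ge zero_le⟩

/-- The Hilbert `𝔽`-module `W^{(2)} = L²(𝔽) ⊗_{ℚ[𝔽]} W` as a submodule of `L²(𝔽)^{n_H}`: the closed
complex span of `W`. -/
def L2Completion (b : f.EdgeLifts H) (W : Submodule ℚ (relChain f.base H)) :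
    Submodule ℂ (L2n H.CoEdge (Pi1 f.base)) :=
  (Submodule.span ℂ ((fun x : relChain f.base H => b.toL2 (x : Chain₁ f.base)) '' W)).topologicalClosure

/-- The embedding `g ↦ t^l g` of `𝔽` into `G_φ`. -/
def cosetEmbedding (l : ℤ) : Pi1 f.base ↪ f.FreeByCyclic where
  toFun g := f.t ^ l * f.incl g
  inj' _ _ hgh := SemidirectProduct.inl_injective (mul_left_cancel hgh)

/-- The induced module: the closure of `⨁_l t^l W^{(2)}` in `L²(G_φ)^{n_H}`. For the quasi-fixed
submodule `W = V_qf` this is `W_qf^{(2)}`. -/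
def inducedL2 (b : f.EdgeLifts H) (W : Submodule ℚ (relChain f.base H)) :
    Submodule ℂ (L2n H.CoEdge f.FreeByCyclic) :=
  (⨆ l : ℤ, (f.L2Completion b W).map
    (l2nMap H.CoEdge (f.cosetEmbedding l)).toLinearMap).topologicalClosure

end BasedHomotopyEquiv

end ChainFlare

end

/-! A bounded two-sided orbit forces membership in both growth subspaces, and the flare condition
forbids slow growth in both directions. The constant is the flare constant.

The inclusion of the quasi-fixed subspace: a Nielsen chain `ρ` comes from a segment with fixed
endpoints in a tree, so `A ρ = ρ` and `A (g ρ) = Φ(g) ρ`. Hence `∑ q_g g ρ` has all its forward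
images, and a backward orbit obtained from `Φ⁻¹`, bounded by `∑ |q_g| ‖ρ‖`. Both growth subspaces
are closed and linear, so they contain the closed span (`inducedL2_subset`).

The converse: split `ξ = η + η'` along the hyperbolic and quasi-fixed parts
(`exists_add_of_sup_eq_top`). By the first inclusion `η` lies in both growth subspaces too, and it
must be shown to vanish. Its real part `ω` on one coset of `𝔽` is a limit of rational chains in
`V_h`. If `ω ≠ 0`, every chain close to `ω` makes a small angle with `V_h` and therefore flares.
Slow forward growth yields a chain `z` near `ω` with `‖A z‖ < ‖z‖`; slow backward growth yields a
chain `w` near `ω` with `‖A w‖ ≥ λ ‖w‖`. As `z` and `w` are both close to `ω` and the operator is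
bounded, this is absurd (`cosetRealPart_eq_zero`).

Two tools connect chains with `L²`: `L_place` identifies the operator with `A` on translates of
chains, and `mem_hsSet_iff` replaces sequences and `limsup` by an approximation property at each
large `j`. -/

noncomputable section

namespace ChainFlare

/-! ### Chains on the universal cover, which is a tree. -/

section Graphs

variable {V : Type u} [Quiver.{v} V]

/-- Allows statements about morphisms of the fundamental groupoid to be proved by induction on an
edge-path. -/
theorem EdgePath.homotopyClass_surjective {a b : V} (p : pt a ⟶ pt b) :
    ∃ q : EdgePath a b, q.homotopyClass = p := by
  induction p using Quot.inductionOn with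
  | h p =>
    change @Quiver.Path (Quiver.Symmetrify V) _ a b at p
    induction p with
    | nil => exact ⟨.nil a, rfl⟩
    | @cons c d p e ih =>
      obtain ⟨q, hq⟩ := ih
      rcases e with e | e
      · refine ⟨.pos q e, ?_⟩
        change q.homotopyClass ≫ edgeClass e = _
        rw [hq]
        rfl
      · refine ⟨.neg q e, ?_⟩
        change q.homotopyClass ≫ Groupoid.inv (edgeClass e) = _
        rw [hq]
        rfl

theorem lift_edgeClass {C : Type*} [Groupoid C] (φ : V ⥤q C) {a b : V} (e : a ⟶ b) :
    (Quiver.FreeGroupoid.lift φ).map (edgeClass e) = φ.map e :=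
  Category.id_comp _

/-- The permutations of the pairs (lifted vertex, chain) by which the lifts of an edge act: the end
of the lift replaces its start and the lift is added to the chain. -/
def edgeTransport (x₀ : V) {a b : V} (e : a ⟶ b) :
    ((pt x₀ ⟶ pt a) × Chain₁ x₀) ≃ ((pt x₀ ⟶ pt b) × Chain₁ x₀) where
  toFun y := (y.1 ≫ edgeClass e, y.2 + Finsupp.single ⟨⟨_, _, e⟩, y.1⟩ 1)
  invFun y := (y.1 ≫ Groupoid.inv (edgeClass e),
    y.2 - Finsupp.single ⟨⟨_, _, e⟩, y.1 ≫ Groupoid.inv (edgeClass e)⟩ 1)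
  left_inv y := by simp
  right_inv y := by simp

/-- Transport of pairs (lifted vertex, chain) along homotopy classes of edge-paths. -/
def chainTransport (x₀ : V) : Quiver.FreeGroupoid V ⥤ Core (Type (max u v)) :=
  Quiver.FreeGroupoid.lift
    { obj := fun a => ⟨(pt x₀ ⟶ pt a) × Chain₁ x₀⟩
      map := fun e => ⟨(edgeTransport x₀ e).toIso⟩ }

theorem chainTransport_edge (x₀ : V) {a b : V} (e : a ⟶ b) :
    (chainTransport x₀).map (edgeClass e) = ⟨(edgeTransport x₀ e).toIso⟩ :=
  lift_edgeClass _ e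

/-- The pair (lifted vertex, chain) that results from transport along `p`. -/
def transport (x₀ : V) {a b : V} (p : pt a ⟶ pt b) (y : (pt x₀ ⟶ pt a) × Chain₁ x₀) :
    (pt x₀ ⟶ pt b) × Chain₁ x₀ :=
  ((chainTransport x₀).map p).iso.hom y

theorem transport_id (x₀ : V) {a : V} (y : (pt x₀ ⟶ pt a) × Chain₁ x₀) :
    transport x₀ (𝟙 (pt a)) y = y := by
  have h : (chainTransport x₀).map (𝟙 (pt a)) = 𝟙 _ := CategoryTheory.Functor.map_id _ _
  rw [transport, h]
  rfl

theorem transport_comp (x₀ : V) {a b c : V} (p : pt a ⟶ pt b) (q : pt b ⟶ pt c)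
    (y : (pt x₀ ⟶ pt a) × Chain₁ x₀) :
    transport x₀ (p ≫ q) y = transport x₀ q (transport x₀ p y) := by
  simp [transport]
  rfl

theorem transport_edge (x₀ : V) {a b : V} (e : a ⟶ b) (y : (pt x₀ ⟶ pt a) × Chain₁ x₀) :
    transport x₀ (edgeClass e) y =
      (y.1 ≫ edgeClass e, y.2 + Finsupp.single ⟨⟨_, _, e⟩, y.1⟩ 1) := by
  rw [transport, chainTransport_edge]
  rfl

theorem transport_fst (x₀ : V) {a b : V} (p : pt a ⟶ pt b) (y : (pt x₀ ⟶ pt a) × Chain₁ x₀) :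
    (transport x₀ p y).1 = y.1 ≫ p := by
  obtain ⟨q, rfl⟩ := EdgePath.homotopyClass_surjective p
  induction q with
  | nil =>
    rw [EdgePath.homotopyClass, transport_id, Category.comp_id]
  | pos q e ih =>
    rw [EdgePath.homotopyClass, transport_comp, transport_edge, ih, Category.assoc]
  | @neg c d q e ih =>
    rw [EdgePath.homotopyClass, transport_comp, ← Category.assoc, ← ih]
    -- Transport along an edge is onto, so the current pair may be written as the image of some `w`;
    -- the inverse edge then undoes that step.
    generalize transport x₀ q.homotopyClass y = z
    obtain ⟨w, rfl⟩ : ∃ w, transport x₀ (edgeClass e) w = z :=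
      ⟨transport x₀ (Groupoid.inv (edgeClass e)) z, by
        rw [← transport_comp, Groupoid.inv_comp, transport_id]⟩
    rw [← transport_comp, Groupoid.comp_inv, transport_id, transport_edge, Category.assoc,
      Groupoid.comp_inv, Category.comp_id]

/-- The chain of the lift, starting at the base vertex, of a homotopy class of edge-paths. -/
def segment {x₀ : V} (u : CoverVertex x₀) : Chain₁ x₀ := (transport x₀ u.2 (𝟙 _, 0)).2

/-- The path to the end of `e` is the path to its start followed by `e`. The chain depends only on
the homotopy class because `chainTransport` is a functor. -/
theorem segment_sub {x₀ : V} (e : CoverEdge x₀) :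
    segment e.t - segment e.o = Finsupp.single e 1 := by
  obtain ⟨⟨a, b, e⟩, p⟩ := e
  change (transport x₀ (p ≫ edgeClass e) _).2 - (transport x₀ p _).2 = _
  rw [transport_comp, transport_edge, transport_fst, Category.id_comp, add_sub_cancel_left]

/-- The universal cover is a tree. -/
theorem boundary_injective (x₀ : V) : Function.Injective (boundary x₀) := by
  -- Sending each vertex to its segment from the base vertex is a left inverse of the boundary, by
  -- `segment_sub`.
  have h : (Finsupp.linearCombination ℚ (segment (x₀ := x₀))) ∘ₗ boundary x₀ = LinearMap.id := by
    ext e : 2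
    simp [boundary, segment_sub]
  exact Function.LeftInverse.injective (g := Finsupp.linearCombination ℚ (segment (x₀ := x₀)))
    fun x => LinearMap.congr_fun h x

theorem boundary_liftChain {x₀ a b : V} (p : pt x₀ ⟶ pt a) (q : EdgePath a b) :
    boundary x₀ (q.liftChain p) =
      Finsupp.single (⟨b, p ≫ q.homotopyClass⟩ : CoverVertex x₀) 1 -
        Finsupp.single (⟨a, p⟩ : CoverVertex x₀) 1 := by
  induction q with
  | nil => simp [EdgePath.liftChain, EdgePath.homotopyClass]
  | pos q e ih =>
    simp [EdgePath.liftChain, EdgePath.homotopyClass, ih]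
    simp [boundary, CoverEdge.t, CoverEdge.o]
  | neg q e ih =>
    simp [EdgePath.liftChain, EdgePath.homotopyClass, ih]
    simp [boundary, CoverEdge.t, CoverEdge.o]

theorem chainAct_single {x₀ : V} (g : Pi1 x₀) (e : CoverEdge x₀) (c : ℚ) :
    chainAct g (Finsupp.single e c) = Finsupp.single (e.act g) c := by
  simp [chainAct]

theorem liftChain_act {x₀ a b : V} (g : Pi1 x₀) (p : pt x₀ ⟶ pt a) (q : EdgePath a b) :
    q.liftChain (g ≫ p) = chainAct g (q.liftChain p) := by
  induction q with
  | nil => simp [EdgePath.liftChain]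
  | pos q e ih => simp [EdgePath.liftChain, ih, chainAct_single, CoverEdge.act]
  | neg q e ih => simp [EdgePath.liftChain, ih, chainAct_single, CoverEdge.act]

theorem liftChain_apply_eq_zero {x₀ a b : V} (p : pt x₀ ⟶ pt a) (q : EdgePath a b)
    (e : CoverEdge x₀) (he : e.1 ∉ q.crossed) : q.liftChain p e = 0 := by
  induction q with
  | nil => simp [EdgePath.liftChain]
  | pos q e' ih =>
    simp only [EdgePath.crossed, Set.mem_insert_iff, not_or] at he
    rw [EdgePath.liftChain, Finsupp.add_apply, ih he.2, Finsupp.single_eq_of_ne, add_zero]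
    rintro rfl
    exact he.1 rfl
  | neg q e' ih =>
    simp only [EdgePath.crossed, Set.mem_insert_iff, not_or] at he
    rw [EdgePath.liftChain, Finsupp.sub_apply, ih he.2, Finsupp.single_eq_of_ne, sub_zero]
    rintro rfl
    exact he.1 rfl

end Graphs

/-! ### Equivariance of `A` and the invariance of fixed segments. -/

theorem basedMap_comp {C : Type*} [Groupoid C] (F : C ⥤ C) {c d d' : C} (h : F.obj c = c)
    (p : c ⟶ d) (q : d ⟶ d') : basedMap F h (p ≫ q) = basedMap F h p ≫ F.map q := by
  simp [basedMap]

theorem basedMap_loop_comp {C : Type*} [Groupoid C] (F : C ⥤ C) {c d : C} (h : F.obj c = c)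
    (g : c ⟶ c) (p : c ⟶ d) : basedMap F h (g ≫ p) = loopHom F h g ≫ basedMap F h p := by
  change eqToHom _ ≫ F.map _ = (eqToHom _ ≫ F.map g ≫ eqToHom _) ≫ eqToHom _ ≫ F.map p
  simp

namespace BasedHomotopyEquiv

variable {V : Type u} [Quiver.{v} V] (f : BasedHomotopyEquiv V)

theorem onClass_comp_edge {a b : V} (p : pt f.base ⟶ pt a) (e : a ⟶ b) :
    f.onClass (p ≫ edgeClass e) = f.onClass p ≫ (f.path e).homotopyClass := by
  have h : f.functor.map (edgeClass e) = (f.path e).homotopyClass := lift_edgeClass _ e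
  rw [← h]
  exact basedMap_comp _ _ _ _

theorem onClass_act {a : V} (g : Pi1 f.base) (p : pt f.base ⟶ pt a) :
    f.onClass (g ≫ p) = (show Pi1 f.base from f.Phi g) ≫ f.onClass p :=
  basedMap_loop_comp _ _ _ _

theorem A_single (e : CoverEdge f.base) :
    f.A (Finsupp.single e 1) = (f.path e.1.hom).liftChain (f.onClass e.2) := by
  simp [A]

theorem A_chainAct (g : Pi1 f.base) (x : Chain₁ f.base) :
    f.A (chainAct g x) = chainAct (f.Phi g) (f.A x) := by
  have h : f.A ∘ₗ chainAct g = chainAct (f.Phi g) ∘ₗ f.A := by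
    ext e : 2
    simp only [LinearMap.comp_apply, Finsupp.lsingle_apply, chainAct_single, A_single]
    rw [← liftChain_act]
    congr 1
    exact f.onClass_act g e.2
  exact LinearMap.congr_fun h x

/-- The lift of `f(e)` joins the images of the endpoints of `e` under the lifted map. -/
theorem boundary_A (x : Chain₁ f.base) :
    boundary f.base (f.A x) = Finsupp.lmapDomain ℚ ℚ f.liftVertex (boundary f.base x) := by
  have h : boundary f.base ∘ₗ f.A = Finsupp.lmapDomain ℚ ℚ f.liftVertex ∘ₗ boundary f.base := by
    ext e : 2
    obtain ⟨⟨a, b, e⟩, p⟩ := e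
    simp only [LinearMap.comp_apply, Finsupp.lsingle_apply, A_single, boundary_liftChain,
      ← onClass_comp_edge]
    simp only [boundary, Finsupp.linearCombination_single, one_smul, map_sub,
      Finsupp.lmapDomain_apply, Finsupp.mapDomain_single]
    rfl
  exact LinearMap.congr_fun h x

variable {f} {H : Subgraph V}

/-- In a tree a 1-chain is determined by its boundary, and `A` preserves that of `c`. -/
theorem A_fixed {u v : CoverVertex f.base} (hu : f.liftVertex u = u) (hv : f.liftVertex v = v)
    {c : Chain₁ f.base} (hc : boundary f.base c = Finsupp.single v 1 - Finsupp.single u 1) :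
    f.A c = c := by
  apply boundary_injective
  rw [boundary_A, hc, map_sub, Finsupp.lmapDomain_apply, Finsupp.lmapDomain_apply,
    Finsupp.mapDomain_single, Finsupp.mapDomain_single, hu, hv]

theorem projRel_single_mem {x₀ : V} (e : CoverEdge x₀) (he : e.1 ∈ H.edges) (c : ℚ) :
    projRel x₀ H (Finsupp.single e c) = 0 := by
  classical exact Subtype.ext (Finsupp.filter_single_of_neg _ (not_not.2 he))

theorem coe_projRel_single {x₀ : V} (e : CoverEdge x₀) (he : e.1 ∉ H.edges) (c : ℚ) :
    (projRel x₀ H (Finsupp.single e c) : Chain₁ x₀) = Finsupp.single e c := by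
  classical exact Finsupp.filter_single_of_pos _ he

theorem projRel_chainAct {x₀ : V} (g : Pi1 x₀) (x : Chain₁ x₀) :
    projRel x₀ H (chainAct g x) = relAct H g (projRel x₀ H x) := by
  have hlin : projRel x₀ H ∘ₗ chainAct g = relAct H g ∘ₗ projRel x₀ H := by
    ext e : 2
    simp only [LinearMap.comp_apply, Finsupp.lsingle_apply, chainAct_single]
    by_cases he : e.1 ∈ H.edges
    · rw [projRel_single_mem e he, projRel_single_mem (e.act g) he, map_zero]
    · refine Subtype.ext ?_
      change _ = chainAct g (projRel x₀ H _ : Chain₁ x₀)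
      rw [coe_projRel_single e he, coe_projRel_single (e.act g) he, chainAct_single]
  exact LinearMap.congr_fun hlin x

theorem ARel_relAct (g : Pi1 f.base) (x : relChain f.base H) :
    f.ARel H (relAct H g x) = relAct H (f.Phi g) (f.ARel H x) := by
  change projRel f.base H (f.A (chainAct g x)) = relAct H _ (projRel f.base H (f.A x))
  rw [A_chainAct, projRel_chainAct]

theorem projRel_apply {x₀ : V} (x : Chain₁ x₀) {e : CoverEdge x₀} (he : e.1 ∉ H.edges) :
    (projRel x₀ H x : Chain₁ x₀) e = x e := by
  classical exact Finsupp.filter_apply_pos _ _ he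

/-- Since `f(H) ⊆ H`, the coefficients on the preimage of `H` contribute nothing outside it. -/
theorem projRel_A_projRel (hH : H.Invariant f.toCellularMap) (x : Chain₁ f.base) :
    projRel f.base H (f.A (projRel f.base H x)) = projRel f.base H (f.A x) := by
  have h : projRel f.base H ∘ₗ f.A ∘ₗ (relChain f.base H).subtype ∘ₗ projRel f.base H =
      projRel f.base H ∘ₗ f.A := by
    ext e : 2
    simp only [LinearMap.comp_apply, Finsupp.lsingle_apply]
    by_cases he : e.1 ∈ H.edges
    · rw [projRel_single_mem e he, map_zero, map_zero, map_zero]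
      refine Subtype.ext (Finsupp.ext fun e' => ?_)
      by_cases he' : e'.1 ∈ H.edges
      · exact ((projRel f.base H _).2 e' he').symm
      · rw [projRel_apply _ he', A_single]
        refine Eq.symm ?_
        exact liftChain_apply_eq_zero _ _ _ fun h => he' (hH.2 _ he h)
    · rw [Submodule.subtype_apply, coe_projRel_single e he]
  exact LinearMap.congr_fun h x

theorem ARel_fixedSegment (hH : H.Invariant f.toCellularMap) {ρ : relChain f.base H}
    (hρ : f.IsFixedSegment H ρ) : f.ARel H ρ = ρ := by
  obtain ⟨u, v, -, hu, hv, c, hc, rfl⟩ := hρ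
  change projRel f.base H (f.A (projRel f.base H c)) = _
  rw [projRel_A_projRel hH, A_fixed hu hv hc]

end BasedHomotopyEquiv

/-! ### Basis vectors and group ring operators on `L²`. -/

section L2

open scoped lp

variable {n G α β : Type*} [Fintype n]

theorem L2n.ext {ξ η : L2n n α} (h : ∀ e a, ξ e a = η e a) : ξ = η :=
  PiLp.ext fun e => lp.ext (funext (h e))

open Classical in
/-- The standard basis vectors of `L²(α)^n`. -/
def basisVec (e : n) (a : α) : L2n n α := WithLp.toLp 2 (Pi.single e (lp.single 2 a 1))

open Classical in
theorem basisVec_apply (e e' : n) (a : α) :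
    basisVec e a e' = if e' = e then lp.single 2 a (1 : ℂ) else 0 := by
  by_cases h : e' = e
  · subst h; simp [basisVec]
  · simp [basisVec, h]

theorem basisVec_self (e : n) (a : α) : basisVec e a e a = 1 := by
  simp [basisVec]

open Classical in
theorem basisVec_of_ne {e e' : n} {a a' : α} (h : e' = e → a' ≠ a) :
    basisVec e a e' a' = 0 := by
  rw [basisVec_apply]
  split_ifs with he
  · exact lp.single_apply_ne _ _ _ (h he)
  · rfl

/-- A closed property of vectors of `L²(α)^n` that is stable under addition and holds for the
multiples of the standard basis vectors holds for all vectors. -/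
theorem L2n.induction {p : L2n n α → Prop} (hc : IsClosed {ξ | p ξ})
    (hadd : ∀ ξ η, p ξ → p η → p (ξ + η)) (h0 : p 0)
    (hb : ∀ (c : ℂ) e a, p (c • basisVec e a)) (ξ : L2n n α) : p ξ := by
  classical
  have hsingle : ∀ (e : n) (η : L2 α), p (WithLp.toLp 2 (Pi.single e η)) := by
    intro e η
    have hη := lp.hasSum_single (p := 2) (by norm_num) η
    have hcont : Continuous fun η : L2 α => (WithLp.toLp 2 (Pi.single e η) : L2n n α) :=
      (PiLp.continuous_toLp 2 _).comp 
        (continuous_single (A := fun _ : n => L2 α) e)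
    refine hc.mem_of_tendsto ((hcont.tendsto η).comp hη) (Eventually.of_forall fun s => ?_)
    have : (WithLp.toLp 2 (Pi.single e (∑ a ∈ s, lp.single 2 a (η a))) : L2n n α) =
        ∑ a ∈ s, η a • basisVec e a := by
      refine L2n.ext fun e' a' => ?_
      by_cases h : e' = e
      · subst h
        simp only [Pi.single_eq_same, basisVec_apply, WithLp.ofLp_sum, Finset.sum_apply,
          WithLp.ofLp_smul, Pi.smul_apply, if_true]
        simp only [lp.coeFn_sum, Finset.sum_apply, lp.coeFn_smul, Pi.smul_apply]
        simp [Pi.single_apply]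
      · simp [basisVec_apply, h]
    change p _
    simp only [Function.comp_apply]
    rw [this]
    exact Finset.sum_induction _ p hadd h0 fun a _ => hb _ _ _
  have : ξ = ∑ e, WithLp.toLp 2 (Pi.single e (ξ e)) := by
    refine PiLp.ext fun e' => ?_
    simp [Finset.sum_pi_single]
  rw [this]
  exact Finset.sum_induction _ p hadd h0 fun e _ => hsingle e _

theorem L2n.map_mem {E : Type*} [NormedAddCommGroup E] [NormedSpace ℂ E] (B : L2n n α →L[ℂ] E)
    {S : Submodule ℂ E} (hS : IsClosed (S : Set E)) (h : ∀ e a, B (basisVec e a) ∈ S)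
    (ξ : L2n n α) : B ξ ∈ S :=
  L2n.induction (p := fun ξ => B ξ ∈ S) (hS.preimage B.continuous)
    (fun ξ η hξ hη => by rw [map_add]; exact add_mem hξ hη) (by rw [map_zero]; exact zero_mem _)
    (fun c e a => by rw [map_smul]; exact S.smul_mem c (h e a)) ξ

theorem L2n.map_ext {E : Type*} [NormedAddCommGroup E] [NormedSpace ℂ E] {B B' : L2n n α →L[ℂ] E}
    (h : ∀ e a, B (basisVec e a) = B' (basisVec e a)) : B = B' :=
  ContinuousLinearMap.ext fun ξ => sub_eq_zero.1 ((Submodule.mem_bot ℂ).1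
    (L2n.map_mem (B - B') (S := ⊥) isClosed_singleton
      (fun e a => (Submodule.mem_bot ℂ).2 (sub_eq_zero.2 (h e a))) ξ))

theorem l2Map_apply (i : α ↪ β) (ξ : L2 α) (b : β) : l2Map i ξ b = Function.extend i ξ 0 b := rfl

open Classical in
theorem l2Map_single (i : α ↪ β) (a : α) (c : ℂ) :
    l2Map i (lp.single 2 a c) = lp.single 2 (i a) c := by
  refine lp.ext (funext fun b => ?_)
  rw [l2Map_apply]
  by_cases hb : ∃ a', i a' = b
  · obtain ⟨a', rfl⟩ := hb
    rw [i.injective.extend_apply]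
    simp [Pi.single_apply]
  · rw [Function.extend_apply' _ _ _ hb, lp.single_apply, Pi.single_eq_of_ne]
    · rfl
    · rintro rfl
      exact hb ⟨a, rfl⟩

theorem l2nMap_apply (i : α ↪ β) (ξ : L2n n α) (e : n) : l2nMap n i ξ e = l2Map i (ξ e) := rfl

theorem norm_l2nMap (i : α ↪ β) (ξ : L2n n α) : ‖l2nMap n i ξ‖ = ‖ξ‖ := by
  rw [PiLp.norm_eq_of_L2, PiLp.norm_eq_of_L2]
  simp [l2nMap_apply]

/-- A finitely supported rational function as an element of `L²(α)`. -/
def ratL2 (p : α →₀ ℚ) : L2 α :=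
  ⟨fun a => ((p a : ℚ) : ℂ), (memℓp_zero (p.hasFiniteSupport.subset fun a ha h =>
    ha (by simp [h]))).of_exponent_ge zero_le⟩

open Classical in
theorem ratL2_eq_sum (p : α →₀ ℚ) : ratL2 p = ∑ a ∈ p.support, lp.single 2 a (p a : ℂ) := by
  refine lp.ext (funext fun a => ?_)
  change (p a : ℂ) = _
  rw [lp.coeFn_sum, Finset.sum_apply]
  simp +contextual [Pi.single_apply]

theorem norm_ratL2_sq (p : α →₀ ℚ) : ‖ratL2 p‖ ^ 2 = ∑ a ∈ p.support, (p a : ℝ) ^ 2 := by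
  classical
  have h := lp.norm_sum_single (p := 2) (by norm_num) (fun a => (p a : ℂ)) p.support
  rw [← ratL2_eq_sum] at h
  simp only [ENNReal.toReal_ofNat, Real.rpow_ofNat] at h
  rw [h]
  exact Finset.sum_congr rfl fun a _ => by
    rw [← Complex.ofReal_ratCast, Complex.norm_real, Real.norm_eq_abs, sq_abs]

variable [Group G]

theorem rightMul_add (x y : MonoidAlgebra ℂ G) : rightMul (x + y) = rightMul x + rightMul y := by
  rw [rightMul, MonoidAlgebra.coeff_add]
  exact Finsupp.sum_add_index' (by simp) (by simp [add_smul])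

theorem rightMul_zero : rightMul (0 : MonoidAlgebra ℂ G) = 0 := Finsupp.sum_zero_index

theorem rightMul_sum {ι : Type*} (s : Finset ι) (x : ι → MonoidAlgebra ℂ G) :
    rightMul (∑ i ∈ s, x i) = ∑ i ∈ s, rightMul (x i) := by
  classical
  induction s using Finset.induction_on with
  | empty => simp [rightMul_zero]
  | insert a s ha ih => rw [Finset.sum_insert ha, Finset.sum_insert ha, rightMul_add, ih]

theorem rightMul_single (g : G) (c : ℂ) :
    rightMul (MonoidAlgebra.single g c) =
      c • (l2Map (mulRightEmbedding g)).toContinuousLinearMap := by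
  rw [rightMul, MonoidAlgebra.coeff_single, Finsupp.sum_single_index (by simp)]

open Classical in
theorem rightMulMatrix_basisVec (M : Matrix n n (MonoidAlgebra ℂ G)) (e e' : n) (γ : G) :
    rightMulMatrix M (basisVec e γ) e' = rightMul (M e e') (lp.single 2 γ 1) := by
  change (∑ i, rightMul (M i e') ∘L PiLp.proj 2 (fun _ : n => L2 G) i) (basisVec e γ) = _
  rw [sum_apply, Finset.sum_eq_single e]
  · simp [basisVec_apply]
  · intro i _ hi
    simp [basisVec_apply, hi]
  · simp

open Classical in
theorem rightMul_sum_single {F : Type*} (i : F ↪ G) (p : F →₀ ℚ) (γ : G) :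
    rightMul (p.sum fun g q => MonoidAlgebra.single (i g) (q : ℂ)) (lp.single 2 γ 1) =
      l2Map (i.trans (mulLeftEmbedding γ)) (ratL2 p) := by
  rw [ratL2_eq_sum, map_sum, Finsupp.sum, rightMul_sum, sum_apply]
  refine Finset.sum_congr rfl fun g _ => ?_
  rw [rightMul_single, l2Map_single]
  change (_ : ℂ) • (l2Map _ _ : L2 G) = _
  rw [l2Map_single, ← lp.single_smul, smul_eq_mul, mul_one]
  rfl

end L2

/-! ### Translates of chains in `L²(G_φ)^{n_H}` and the action of the operator on them. -/

namespace BasedHomotopyEquiv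

open scoped lp

variable {V : Type u} [Quiver.{v} V] {f : BasedHomotopyEquiv V} {H : Subgraph V}

theorem EdgeLifts.exists_act_eq (b : f.EdgeLifts H) (E : CoverEdge f.base) (hE : E.1 ∉ H.edges) :
    ∃ (e : H.CoEdge) (g : Pi1 f.base), (b.edge e).act g = E := by
  refine ⟨⟨E.1, hE⟩, E.2 ≫ Groupoid.inv (b ⟨E.1, hE⟩), Sigma.ext rfl (heq_of_eq ?_)⟩
  change (E.2 ≫ Groupoid.inv (b ⟨E.1, hE⟩)) ≫ b ⟨E.1, hE⟩ = E.2
  rw [Category.assoc, Groupoid.inv_comp, Category.comp_id]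

theorem EdgeLifts.act_eq_act (b : f.EdgeLifts H) {e e' : H.CoEdge} {g g' : Pi1 f.base}
    (h : (b.edge e).act g = (b.edge e').act g') : e = e' ∧ g = g' := by
  have he : e = e' := Subtype.ext (congrArg Sigma.fst h)
  subst he
  exact ⟨rfl, (b.edge e).act_left_injective h⟩

theorem EdgeLifts.coord_apply (b : f.EdgeLifts H) (x : Chain₁ f.base) (e : H.CoEdge)
    (g : Pi1 f.base) : b.coord x e g = x ((b.edge e).act g) := rfl

/-- The same twist as in `A (g x) = Φ(g) A x`, which is why the factor `t` turns the semilinear `A`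
into an operator commuting with left translations. -/
theorem incl_mul_t (g : Pi1 f.base) : f.incl g * f.t = f.t * f.incl (f.Phi g) := by
  rw [← f.t_inv_mul_incl_mul_t]
  group

/-- The embedding `g ↦ γ g` of `𝔽` into `G_φ`. -/
def translateEmbedding (γ : f.FreeByCyclic) : Pi1 f.base ↪ f.FreeByCyclic where
  toFun g := γ * f.incl g
  inj' _ _ hgh := SemidirectProduct.inl_injective (mul_left_cancel hgh)

variable [Finite (Quiver.Total V)] (b : f.EdgeLifts H)

/-- The translate by `γ ∈ G_φ` of a 1-chain, as a vector of `L²(G_φ)^{n_H}`. -/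
def place (γ : f.FreeByCyclic) (x : Chain₁ f.base) : L2n H.CoEdge f.FreeByCyclic :=
  l2nMap H.CoEdge (translateEmbedding γ) (b.toL2 x)

theorem place_apply (γ : f.FreeByCyclic) (x : Chain₁ f.base) (e : H.CoEdge) :
    place b γ x e = l2Map (translateEmbedding γ) (ratL2 (b.coord x e)) := rfl

theorem place_apply_apply (γ : f.FreeByCyclic) (x : Chain₁ f.base) (e : H.CoEdge)
    (g : Pi1 f.base) : place b γ x e (γ * f.incl g) = (x ((b.edge e).act g) : ℂ) :=
  (translateEmbedding γ).injective.extend_apply _ _ g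

theorem place_apply_of_notMem (γ γ' : f.FreeByCyclic) (x : Chain₁ f.base) (e : H.CoEdge)
    (h : ∀ g, γ * f.incl g ≠ γ') : place b γ x e γ' = 0 :=
  Function.extend_apply' _ _ _ fun ⟨g, hg⟩ => h g hg

theorem place_ext {γ : f.FreeByCyclic} {x : Chain₁ f.base} {ξ : L2n H.CoEdge f.FreeByCyclic}
    (h₁ : ∀ e g, ξ e (γ * f.incl g) = (x ((b.edge e).act g) : ℂ))
    (h₂ : ∀ e γ', (∀ g, γ * f.incl g ≠ γ') → ξ e γ' = 0) : ξ = place b γ x := by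
  refine L2n.ext fun e γ' => ?_
  by_cases h : ∃ g, γ * f.incl g = γ'
  · obtain ⟨g, rfl⟩ := h
    rw [h₁, place_apply_apply]
  · push Not at h
    rw [h₂ _ _ h, place_apply_of_notMem b _ _ _ _ h]

theorem place_add (γ : f.FreeByCyclic) (x y : Chain₁ f.base) :
    place b γ (x + y) = place b γ x + place b γ y := by
  refine (place_ext b (fun e g => ?_) fun e γ' h => ?_).symm
  · rw [PiLp.add_apply, lp.coeFn_add, Pi.add_apply, place_apply_apply, place_apply_apply]
    simp
  · rw [PiLp.add_apply, lp.coeFn_add, Pi.add_apply, place_apply_of_notMem b _ _ _ _ h,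
      place_apply_of_notMem b _ _ _ _ h, add_zero]

theorem place_smul (γ : f.FreeByCyclic) (c : ℚ) (x : Chain₁ f.base) :
    place b γ (c • x) = (c : ℂ) • place b γ x := by
  refine (place_ext b (fun e g => ?_) fun e γ' h => ?_).symm
  · rw [PiLp.smul_apply, lp.coeFn_smul, Pi.smul_apply, place_apply_apply]
    simp
  · rw [PiLp.smul_apply, lp.coeFn_smul, Pi.smul_apply, place_apply_of_notMem b _ _ _ _ h,
      smul_zero]

/-- `place` as an additive map. -/
def placeHom (γ : f.FreeByCyclic) : Chain₁ f.base →+ L2n H.CoEdge f.FreeByCyclic :=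
  AddMonoidHom.mk' (place b γ) (place_add b γ)

theorem place_zero (γ : f.FreeByCyclic) : place b γ 0 = 0 := (placeHom b γ).map_zero

theorem place_sub (γ : f.FreeByCyclic) (x y : Chain₁ f.base) :
    place b γ (x - y) = place b γ x - place b γ y := (placeHom b γ).map_sub x y

theorem place_sum {ι : Type*} (γ : f.FreeByCyclic) (s : Finset ι) (x : ι → Chain₁ f.base) :
    place b γ (∑ i ∈ s, x i) = ∑ i ∈ s, place b γ (x i) := map_sum (placeHom b γ) x s

theorem place_chainAct (γ : f.FreeByCyclic) (h : Pi1 f.base) (x : Chain₁ f.base) :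
    place b γ (chainAct h x) = place b (γ * f.incl h) x := by
  refine (place_ext b (fun e g => ?_) fun e γ' hγ => ?_).symm
  · have h₁ : γ * f.incl g = γ * f.incl h * f.incl (h⁻¹ * g) := by
      rw [mul_assoc, ← map_mul, mul_inv_cancel_left]
    have h₂ : (b.edge e).act g = CoverEdge.act h ((b.edge e).act (h⁻¹ * g)) := by
      conv_lhs => rw [← mul_inv_cancel_left h g]
      exact Sigma.ext rfl (heq_of_eq (Category.assoc _ _ _))
    rw [h₁, place_apply_apply, h₂]
    exact congrArg _ (Finsupp.mapDomain_apply (CoverEdge.act_injective h) x _).symm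
  · refine place_apply_of_notMem b _ _ _ _ fun g hg => hγ (h * g) ?_
    rw [← hg, map_mul, mul_assoc]

theorem place_projRel (γ : f.FreeByCyclic) (x : Chain₁ f.base) :
    place b γ (projRel f.base H x) = place b γ x := by
  refine (place_ext b (fun e g => ?_) fun e γ' h => place_apply_of_notMem b _ _ _ _ h).symm
  rw [place_apply_apply, projRel_apply]
  exact e.2

theorem place_edge (γ : f.FreeByCyclic) (e : H.CoEdge) :
    place b γ (Finsupp.single (b.edge e) 1) = basisVec e γ := by
  classical
  have h₁ : (b.edge e).act (1 : Pi1 f.base) = b.edge e :=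
    Sigma.ext rfl (heq_of_eq (Category.id_comp _))
  refine (place_ext b (fun e' g => ?_) fun e' γ' h => ?_).symm
  · by_cases hg : e' = e ∧ g = 1
    · obtain ⟨rfl, rfl⟩ := hg
      rw [h₁, map_one, mul_one, basisVec_self]
      simp
    · rw [basisVec_of_ne, Finsupp.single_eq_of_ne]
      · simp
      · intro h
        exact hg (b.act_eq_act (h.trans h₁.symm))
      · exact fun he h => hg ⟨he, SemidirectProduct.inl_injective
          ((mul_eq_left.1 h).trans (map_one f.incl).symm)⟩
  · refine basisVec_of_ne fun _ h' => h 1 ?_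
    rw [map_one, mul_one, h']

theorem place_act_edge (γ : f.FreeByCyclic) (e : H.CoEdge) (g : Pi1 f.base) :
    place b γ (Finsupp.single ((b.edge e).act g) 1) = basisVec e (γ * f.incl g) := by
  rw [← chainAct_single, place_chainAct, place_edge]

/-- Each edge outside the preimage of `H` is a translate of one chosen lift by one group element.
The chain has to be relative, as `place` does not see its other coefficients. -/
theorem norm_place (γ : f.FreeByCyclic) (x : relChain f.base H) :
    ‖place b γ (x : Chain₁ f.base)‖ = chainNorm (x : Chain₁ f.base) := by
  rw [place, norm_l2nMap, chainNorm, PiLp.norm_eq_of_L2]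
  congr 1
  change ∑ e, ‖ratL2 (b.coord x e)‖ ^ 2 = _
  simp only [norm_ratL2_sq]
  rw [Finset.sum_sigma', chainInner, Finsupp.sum]
  refine Finset.sum_bij (fun p _ => (b.edge p.1).act p.2) ?_ ?_ ?_ ?_
  · rintro ⟨e, g⟩ h
    simpa [EdgeLifts.coord_apply] using h
  · rintro ⟨e, g⟩ _ ⟨e', g'⟩ _ h
    obtain ⟨rfl, rfl⟩ := b.act_eq_act h
    rfl
  · intro E hE
    obtain ⟨e, g, rfl⟩ := b.exists_act_eq E fun h => Finsupp.mem_support_iff.1 hE (x.2 E h)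
    exact ⟨⟨e, g⟩, by simpa [EdgeLifts.coord_apply] using hE, rfl⟩
  · rintro ⟨e, g⟩ _
    exact sq _

/-- The matrix over the group ring of `G_φ` whose row at `e` is `s` times the row of coordinates of
the 1-chain `y e`. -/
def chainMatrix (s : f.FreeByCyclic) (y : H.CoEdge → Chain₁ f.base) :
    Matrix H.CoEdge H.CoEdge (MonoidAlgebra ℂ f.FreeByCyclic) :=
  fun e e' => (b.coord (y e) e').sum fun g q => MonoidAlgebra.single (s * f.incl g) (q : ℂ)

theorem rightMulMatrix_chainMatrix (s : f.FreeByCyclic) (y : H.CoEdge → Chain₁ f.base)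
    (e : H.CoEdge) (γ : f.FreeByCyclic) :
    rightMulMatrix (chainMatrix b s y) (basisVec e γ) = place b (γ * s) (y e) := by
  refine PiLp.ext fun e' => ?_
  refine (rightMulMatrix_basisVec _ _ _ _).trans ?_
  refine (rightMul_sum_single (translateEmbedding s) _ γ).trans ?_
  have : (translateEmbedding s).trans (mulLeftEmbedding γ) = translateEmbedding (γ * s) :=
    Function.Embedding.ext fun g => (mul_assoc _ _ _).symm
  rw [this, place_apply]

variable {b}

/-- By linearity it is enough to treat one edge. On an edge over `H` both sides vanish by
invariance; on a translate of a chosen lift it is the definition of the matrix, after moving the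
translating element past `t`. -/
theorem L_place (hH : H.Invariant f.toCellularMap) (γ : f.FreeByCyclic) (x : Chain₁ f.base) :
    f.L b (place b γ x) = place b (γ * f.t) (f.A x) := by
  induction x using Finsupp.induction_linear with
  | zero => simp [place_zero]
  | add x y hx hy => rw [place_add, map_add, hx, hy, map_add, place_add]
  | single E c =>
    rw [← mul_one c, ← smul_eq_mul, ← Finsupp.smul_single, map_smul, place_smul, place_smul,
      map_smul]
    congr 1
    by_cases hE : E.1 ∈ H.edges
    · rw [← place_projRel b γ, ← place_projRel b _ (f.A _), ← projRel_A_projRel hH,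
        projRel_single_mem E hE]
      simp [place_zero]
    · obtain ⟨e, g, rfl⟩ := b.exists_act_eq E hE
      rw [place_act_edge, ← chainAct_single, A_chainAct, place_chainAct, mul_assoc γ f.t,
        ← incl_mul_t, ← mul_assoc]
      exact rightMulMatrix_chainMatrix b f.t _ e _

theorem L_place_rel (hH : H.Invariant f.toCellularMap) (γ : f.FreeByCyclic)
    (x : relChain f.base H) :
    f.L b (place b γ (x : Chain₁ f.base)) = place b (γ * f.t) (f.ARel H x : Chain₁ f.base) := by
  rw [L_place hH]
  exact (place_projRel b _ _).symm

theorem L_pow_place_rel (hH : H.Invariant f.toCellularMap) (j : ℕ) (γ : f.FreeByCyclic)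
    (x : relChain f.base H) :
    (f.L b ^ j) (place b γ (x : Chain₁ f.base)) =
      place b (γ * f.t ^ j) ((f.ARel H ^ j) x : Chain₁ f.base) := by
  induction j generalizing γ x with
  | zero => simp
  | succ j ih =>
    rw [pow_succ, mul_apply_eq_comp, L_place_rel hH, ih, mul_assoc, ← pow_succ',
      pow_succ (f.ARel H), Module.End.mul_apply]

end BasedHomotopyEquiv

/-! ### The growth subspaces are closed and linear. -/

section HaagerupSchultz

theorem exists_tendsto_diagonal {P : ℕ → ℕ → Prop}
    (h : ∀ n, ∀ᶠ j in atTop, P n j) :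
    ∃ N : ℕ → ℕ, Tendsto N atTop atTop ∧ ∀ᶠ j in atTop, P (N j) j := by
  classical
  -- The largest `n ≤ j` for which `P n j` holds. The default value is `0`, so the property is
  -- guaranteed only once `P 0 j` holds.
  refine ⟨fun j => Nat.findGreatest (fun n => P n j) j, ?_, ?_⟩
  · refine tendsto_atTop.2 fun n => ?_
    filter_upwards [h n, eventually_ge_atTop n] with j hj hnj
    exact Nat.le_findGreatest hnj hj
  · filter_upwards [h 0] with j hj
    exact Nat.findGreatest_spec (P := fun n => P n j) (Nat.zero_le j) hj

theorem eventually_mul_pow_le (C : ℝ) {μ' μ : ℝ} (h₀ : 0 < μ') (h : μ' < μ) :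
    ∀ᶠ j : ℕ in atTop, C * μ' ^ j ≤ μ ^ j := by
  have h₁ : 1 < μ / μ' := (one_lt_div h₀).2 h
  filter_upwards [(tendsto_pow_atTop_atTop_of_one_lt h₁).eventually_ge_atTop C] with j hj
  rwa [div_pow, le_div_iff₀ (pow_pos h₀ j)] at hj

variable {E : Type*} [NormedAddCommGroup E]

theorem limsup_enorm_rpow_le_iff {w : ℕ → E} {ν : ℝ} (hν : 0 ≤ ν) :
    limsup (fun j : ℕ => ‖w j‖ₑ ^ (1 / (j : ℝ))) atTop ≤ ENNReal.ofReal ν ↔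
      ∀ μ, ν < μ → ∀ᶠ j in atTop, ‖w j‖ < μ ^ j := by
  -- At `j = 0` the exponent `1 / j` is `0`, so that index is excluded; the `limsup` ignores it.
  have key : ∀ {μ : ℝ} {j : ℕ}, 0 < μ → 0 < j →
      (‖w j‖ₑ ^ (1 / (j : ℝ)) < ENNReal.ofReal μ ↔ ‖w j‖ < μ ^ j) := by
    intro μ j hμ hj
    rw [one_div, ENNReal.rpow_inv_lt_iff (by exact_mod_cast hj), ENNReal.rpow_natCast,
      ← ENNReal.ofReal_pow hμ.le, ← ofReal_norm,
      ENNReal.ofReal_lt_ofReal_iff (pow_pos hμ j)]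
  constructor
  · intro h μ hμ
    have hμ₀ := hν.trans_lt hμ
    filter_upwards [eventually_lt_of_limsup_lt
      (h.trans_lt ((ENNReal.ofReal_lt_ofReal_iff hμ₀).2 hμ)), eventually_gt_atTop 0] with j hj hj₀
    exact (key hμ₀ hj₀).1 hj
  · intro h
    refine le_of_forall_gt fun c hc => ?_
    obtain ⟨μ, -, hμ, hμc⟩ := ENNReal.lt_iff_exists_real_btwn.1 hc
    have hμ' : ν < μ := (ENNReal.ofReal_lt_ofReal_iff_of_nonneg hν).1 hμ
    refine lt_of_le_of_lt (limsup_le_of_le (h := ?_)) hμc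
    filter_upwards [h μ hμ', eventually_gt_atTop 0] with j hj hj₀
    exact ((key (hν.trans_lt hμ') hj₀).2 hj).le

variable [NormedSpace ℂ E]

/-- The common form of the subspaces of Haagerup and Schultz: the limits of sequences `U j (s j)` for
which `W j (s j)` has exponential growth rate at most `ν`. -/
def hsSet (U W : ℕ → E →L[ℂ] E) (ν : ℝ) : Set E :=
  {ξ | ∃ s : ℕ → E, Tendsto (fun j => ‖U j (s j) - ξ‖) atTop (𝓝 0) ∧
    limsup (fun j : ℕ => ‖W j (s j)‖ₑ ^ (1 / (j : ℝ))) atTop ≤ ENNReal.ofReal ν}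

theorem hsE_eq_hsSet (B : E →L[ℂ] E) (ν : ℝ) : hsE B ν = hsSet (fun _ => 1) (B ^ ·) ν := rfl

theorem hsF_inv_eq_hsSet (B : E →L[ℂ] E) (ν : ℝ) : hsF B ν⁻¹ = hsSet (B ^ ·) (fun _ => 1) ν := by
  conv_rhs => rw [← inv_inv ν]
  rfl

variable {U W : ℕ → E →L[ℂ] E} {ν : ℝ}

/-- A diagonal choice along `ε = 1/(n+1)` and `μ = ν + 1/(n+1)` assembles the approximants into one
sequence. In this form, sums and limits need no choice of sequences. -/
theorem mem_hsSet_iff (hν : 0 ≤ ν) {ξ : E} :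
    ξ ∈ hsSet U W ν ↔ ∀ μ, ν < μ → ∀ ε, 0 < ε →
      ∀ᶠ j in atTop, ∃ η, ‖U j η - ξ‖ < ε ∧ ‖W j η‖ < μ ^ j := by
  constructor
  · rintro ⟨s, hs, hlim⟩ μ hμ ε hε
    filter_upwards [hs.eventually_lt_const hε, (limsup_enorm_rpow_le_iff hν).1 hlim μ hμ]
      with j h₁ h₂ using ⟨s j, h₁, h₂⟩
  · intro h
    have hpos : ∀ n : ℕ, (0 : ℝ) < 1 / (n + 1) := fun n => by positivity
    obtain ⟨N, hN, hP⟩ := exists_tendsto_diagonal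
      (P := fun n j => ∃ η, ‖U j η - ξ‖ < 1 / (n + 1 : ℝ) ∧ ‖W j η‖ < (ν + 1 / (n + 1 : ℝ)) ^ j)
      (fun n => h _ (lt_add_of_pos_right _ (hpos n)) _ (hpos n))
    choose! s hs using fun (j : ℕ)
      (hj : ∃ η, ‖U j η - ξ‖ < 1 / (N j + 1 : ℝ) ∧ ‖W j η‖ < (ν + 1 / (N j + 1 : ℝ)) ^ j) => hj
    have hlim : Tendsto (fun j => (1 : ℝ) / (N j + 1)) atTop (𝓝 0) :=
      (tendsto_one_div_add_atTop_nhds_zero_nat (𝕜 := ℝ)).comp hN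
    refine ⟨s, ?_, (limsup_enorm_rpow_le_iff hν).2 fun μ hμ => ?_⟩
    · refine squeeze_zero' (Eventually.of_forall fun _ => norm_nonneg _) ?_ hlim
      filter_upwards [hP] with j hj using (hs j hj).1.le
    · filter_upwards [hP, hlim.eventually_lt_const (sub_pos.2 hμ)] with j hj hj'
      refine (hs j hj).2.trans_le (pow_le_pow_left₀ ?_ ?_ j)
      · have := hpos (N j)
        positivity
      · linarith

variable (U W) in
/-- `hsSet U W ν` as a linear subspace. -/
def hsSubmodule (hν : 0 < ν) : Submodule ℂ E where
  carrier := hsSet U W ν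
  zero_mem' := (mem_hsSet_iff hν.le).2 fun μ hμ ε hε => Eventually.of_forall fun j =>
    ⟨0, by simpa using hε, by simpa using pow_pos (hν.trans hμ) j⟩
  add_mem' := by
    intro ξ ξ' hξ hξ'
    rw [mem_hsSet_iff hν.le] at *
    intro μ hμ ε hε
    -- The rate is halfway between `ν` and `μ`, so that the factor `2` of the sum is absorbed for
    -- large `j`.
    filter_upwards [hξ _ (left_lt_add_div_two.2 hμ) _ (half_pos hε),
      hξ' _ (left_lt_add_div_two.2 hμ) _ (half_pos hε),
      eventually_mul_pow_le 2 (hν.trans (left_lt_add_div_two.2 hμ)) (add_div_two_lt_right.2 hμ)]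
      with j ⟨η, h₁, h₂⟩ ⟨η', h₁', h₂'⟩ h
    refine ⟨η + η', ?_, ?_⟩
    · rw [map_add, add_sub_add_comm]
      exact (norm_add_le _ _).trans_lt (by linarith)
    · rw [map_add]
      exact (norm_add_le _ _).trans_lt (by linarith)
  smul_mem' := by
    intro c ξ hξ
    rw [mem_hsSet_iff hν.le] at *
    intro μ hμ ε hε
    -- `‖c‖ + 1` in place of `‖c‖` covers `c = 0`.
    have hc : 0 < ‖c‖ + 1 := by positivity
    filter_upwards [hξ _ (left_lt_add_div_two.2 hμ) _ (div_pos hε hc),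
      eventually_mul_pow_le (‖c‖ + 1) (hν.trans (left_lt_add_div_two.2 hμ))
        (add_div_two_lt_right.2 hμ)] with j ⟨η, h₁, h₂⟩ h
    have hle : ∀ r : ℝ, 0 ≤ r → ‖c‖ * r ≤ r * (‖c‖ + 1) := fun r hr => by nlinarith
    refine ⟨c • η, ?_, ?_⟩
    · rw [map_smul, ← smul_sub, norm_smul]
      exact (hle _ (norm_nonneg _)).trans_lt ((lt_div_iff₀ hc).1 h₁)
    · rw [map_smul, norm_smul]
      refine (hle _ (norm_nonneg _)).trans_lt (lt_of_lt_of_le ?_ h)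
      rw [mul_comm]
      exact mul_lt_mul_of_pos_left h₂ hc

theorem isClosed_hsSubmodule (hν : 0 < ν) : IsClosed (hsSubmodule U W hν : Set E) := by
  refine isClosed_of_closure_subset fun ξ hξ => (mem_hsSet_iff hν.le).2 fun μ hμ ε hε => ?_
  obtain ⟨ξ', hξ', hd⟩ := Metric.mem_closure_iff.1 hξ _ (half_pos hε)
  filter_upwards [(mem_hsSet_iff hν.le).1 hξ' μ hμ _ (half_pos hε)] with j ⟨η, h₁, h₂⟩
  refine ⟨η, ?_, h₂⟩
  rw [← sub_add_sub_cancel _ ξ']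
  rw [dist_comm, dist_eq_norm] at hd
  exact (norm_add_le _ _).trans_lt (by linarith)

theorem mem_hsSet_of_bounded (hν : 1 ≤ ν) {ξ : E} (C : ℝ)
    (h : ∀ j, ∃ η, U j η = ξ ∧ ‖W j η‖ ≤ C) : ξ ∈ hsSet U W ν := by
  refine (mem_hsSet_iff (zero_le_one.trans hν)).2 fun μ hμ ε hε => ?_
  filter_upwards [eventually_mul_pow_le (C + 1) one_pos (hν.trans_lt hμ)] with j hj
  obtain ⟨η, h₁, h₂⟩ := h j
  refine ⟨η, by simpa [h₁] using hε, ?_⟩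
  rw [one_pow] at hj
  linarith

end HaagerupSchultz

/-! ### Real parts of coefficients on a subset of the group. -/

section RealPart

variable {n G : Type*} [Fintype n]

open Classical in
/-- The real parts of the coefficients at the elements of `S`. -/
def realPart (S : Set G) : L2n n G →+ L2n n G where
  toFun ξ := WithLp.toLp 2 fun e => ⟨fun γ => if γ ∈ S then ((ξ e γ).re : ℂ) else 0,
    (ξ e).2.mono' fun γ => by
      split_ifs
      · rw [Complex.norm_real]
        exact Complex.abs_re_le_norm _
      · rw [norm_zero]
        exact norm_nonneg _⟩
  map_zero' := by
    refine L2n.ext fun e γ => ?_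
    change (if γ ∈ S then (((0 : ℂ).re : ℝ) : ℂ) else 0) = 0
    simp
  map_add' ξ η := by
    refine L2n.ext fun e γ => ?_
    change (if γ ∈ S then (((ξ e γ + η e γ).re : ℝ) : ℂ) else 0) =
      (if γ ∈ S then ((ξ e γ).re : ℂ) else 0) + if γ ∈ S then ((η e γ).re : ℂ) else 0
    split_ifs <;> simp

theorem realPart_apply_of_mem {S : Set G} {γ : G} (h : γ ∈ S) (ξ : L2n n G) (e : n) :
    realPart S ξ e γ = ((ξ e γ).re : ℂ) := if_pos h

theorem realPart_apply_of_notMem {S : Set G} {γ : G} (h : γ ∉ S) (ξ : L2n n G) (e : n) :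
    realPart S ξ e γ = 0 := if_neg h

theorem norm_realPart_le (S : Set G) (ξ : L2n n G) : ‖realPart S ξ‖ ≤ ‖ξ‖ := by
  rw [PiLp.norm_eq_of_L2, PiLp.norm_eq_of_L2]
  refine Real.sqrt_le_sqrt (Finset.sum_le_sum fun e _ => ?_)
  refine pow_le_pow_left₀ (norm_nonneg _) (lp.norm_mono (by norm_num) fun γ => ?_) 2
  by_cases h : γ ∈ S
  · rw [realPart_apply_of_mem h, Complex.norm_real]
    exact Complex.abs_re_le_norm _
  · rw [realPart_apply_of_notMem h, norm_zero]
    exact norm_nonneg _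

theorem continuous_realPart (S : Set G) : Continuous (realPart S : L2n n G → L2n n G) :=
  AddMonoidHomClass.continuous_of_bound _ 1 fun ξ => by
    rw [one_mul]
    exact norm_realPart_le S ξ

end RealPart

/-! ### Small angles and exponential growth from flaring. -/

section Angle

variable {V : Type u} [Quiver.{v} V] {x₀ : V} {H : Subgraph V}

theorem chainInner_eq_sum {x y : Chain₁ x₀} {s : Finset (CoverEdge x₀)} (hs : x.support ⊆ s) :
    chainInner x y = ∑ e ∈ s, (x e : ℝ) * y e :=
  Finsupp.sum_of_support_subset _ hs _ (by simp)

theorem chainNorm_sq (x : Chain₁ x₀) : chainNorm x ^ 2 = chainInner x x :=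
  Real.sq_sqrt (Finset.sum_nonneg fun _ _ => mul_self_nonneg _)

theorem chainNorm_sub_sq (x y : Chain₁ x₀) :
    chainNorm (x - y) ^ 2 = chainNorm x ^ 2 + chainNorm y ^ 2 - 2 * chainInner x y := by
  classical
  have h₁ : x.support ⊆ x.support ∪ y.support := Finset.subset_union_left
  have h₂ : y.support ⊆ x.support ∪ y.support := Finset.subset_union_right
  rw [chainNorm_sq, chainNorm_sq, chainNorm_sq, chainInner_eq_sum Finsupp.support_sub,
    chainInner_eq_sum (y := x) h₁, chainInner_eq_sum (y := y) h₁, chainInner_eq_sum (y := y) h₂,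
    Finset.mul_sum, ← Finset.sum_add_distrib, ← Finset.sum_sub_distrib]
  refine Finset.sum_congr rfl fun e _ => ?_
  rw [Finsupp.sub_apply]
  push_cast
  ring

-- From `2⟨x,y⟩ = ‖x‖² + ‖y‖² - ‖x-y‖²` and `‖x‖² + ‖y‖² ≥ 2‖x‖‖y‖`.
open BasedHomotopyEquiv in
theorem mem_angleNhd {θ : ℝ} {W : Submodule ℚ (relChain x₀ H)} {x y : relChain x₀ H} (hx : x ∈ W)
    (h : chainNorm ((x : Chain₁ x₀) - (y : Chain₁ x₀)) ^ 2 <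
      2 * (1 - θ) * (chainNorm (x : Chain₁ x₀) * chainNorm (y : Chain₁ x₀))) :
    y ∈ angleNhd θ W := by
  refine ⟨x, hx, ?_⟩
  rw [chainNorm_sub_sq] at h
  nlinarith [sq_nonneg (chainNorm (x : Chain₁ x₀) - chainNorm (y : Chain₁ x₀))]

end Angle

/-- Once the sequence fails to decrease, the maximum cannot be the earlier term, because `lam > 1`;
so it is the later one at each following step. -/
theorem growth_of_flare {a : ℕ → ℝ} {lam : ℝ} (hlam : 1 < lam) {J : ℕ}
    (h : ∀ k, k + 2 ≤ J → lam * a (k + 1) ≤ max (a (k + 2)) (a k)) (h₀ : 0 < a 0)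
    (h₁ : a 0 ≤ a 1) : ∀ k, k + 1 ≤ J → a k ≤ a (k + 1) ∧ lam ^ k * a 0 ≤ a (k + 1) := by
  intro k
  induction k with
  | zero => simpa using fun _ => h₁
  | succ k ih =>
    intro hk
    obtain ⟨hle, hpow⟩ := ih (by omega)
    have hpos : 0 < a (k + 1) := lt_of_lt_of_le (by positivity) hpow
    have hgrow : lam * a (k + 1) ≤ a (k + 2) := by
      rcases le_max_iff.1 (h k hk) with h | h
      · exact h
      · nlinarith
    constructor
    · nlinarith
    · rw [pow_succ', mul_assoc]
      exact (mul_le_mul_of_nonneg_left hpow (by linarith)).trans hgrow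

/-! ### Cosets of `𝔽`, induced subspaces and rational approximation. -/

namespace BasedHomotopyEquiv

open scoped lp

variable {V : Type u} [Quiver.{v} V] {f : BasedHomotopyEquiv V} {H : Subgraph V}

/-- The exponent of `t` in an element of `G_φ`. -/
def level (γ : f.FreeByCyclic) : ℤ := Multiplicative.toAdd γ.right

theorem level_t_zpow_mul_incl (l : ℤ) (g : Pi1 f.base) : level (f.t ^ l * f.incl g) = l := by
  have h : (SemidirectProduct.rightHom (f.t ^ l * f.incl g) : Multiplicative ℤ) =
      Multiplicative.ofAdd 1 ^ l := by
    rw [map_mul, map_zpow, t, incl, SemidirectProduct.rightHom_inr, SemidirectProduct.rightHom_inl,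
      mul_one]
  change Multiplicative.toAdd (SemidirectProduct.rightHom (f.t ^ l * f.incl g)) = l
  rw [h]
  simp

theorem exists_eq_t_zpow_mul_incl (γ : f.FreeByCyclic) :
    ∃ (l : ℤ) (g : Pi1 f.base), γ = f.t ^ l * f.incl g := by
  have h : f.t ^ (-level γ) * γ ∈ (SemidirectProduct.rightHom :
      f.FreeByCyclic →* Multiplicative ℤ).ker := by
    rw [MonoidHom.mem_ker, map_mul, map_zpow, t, SemidirectProduct.rightHom_inr]
    change Multiplicative.ofAdd 1 ^ (-Multiplicative.toAdd γ.right) * γ.right = 1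
    apply Multiplicative.toAdd.injective
    simp
  rw [← SemidirectProduct.range_inl_eq_ker_rightHom] at h
  obtain ⟨g, hg⟩ := h
  refine ⟨level γ, g, ?_⟩
  change f.incl g = _ at hg
  rw [hg, zpow_neg, mul_inv_cancel_left]

variable [Finite (Quiver.Total V)] (b : f.EdgeLifts H)

theorem place_mem_inducedL2 {W : Submodule ℚ (relChain f.base H)} (l : ℤ)
    {x : relChain f.base H} (hx : x ∈ W) :
    place b (f.t ^ l) (x : Chain₁ f.base) ∈ f.inducedL2 b W :=
  Submodule.le_topologicalClosure _ (Submodule.mem_iSup_of_mem l ⟨_,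
    Submodule.le_topologicalClosure _ (Submodule.subset_span ⟨x, hx, rfl⟩), rfl⟩)

theorem inducedL2_le {W : Submodule ℚ (relChain f.base H)}
    {S : Submodule ℂ (L2n H.CoEdge f.FreeByCyclic)}
    (hS : IsClosed (S : Set (L2n H.CoEdge f.FreeByCyclic)))
    (h : ∀ (l : ℤ), ∀ x ∈ W, place b (f.t ^ l) (x : Chain₁ f.base) ∈ S) :
    f.inducedL2 b W ≤ S := by
  refine Submodule.topologicalClosure_minimal _ (iSup_le fun l => ?_) hS
  refine Submodule.map_le_iff_le_comap.2 (Submodule.topologicalClosure_minimal _ ?_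
    (hS.preimage (l2nMap H.CoEdge (f.cosetEmbedding l)).continuous))
  refine Submodule.span_le.2 ?_
  rintro _ ⟨x, hx, rfl⟩
  exact h l x hx

theorem isClosed_inducedL2 (W : Submodule ℚ (relChain f.base H)) :
    IsClosed (f.inducedL2 b W : Set (L2n H.CoEdge f.FreeByCyclic)) :=
  Submodule.isClosed_topologicalClosure _

theorem basisVec_eq_place (e : H.CoEdge) (γ : f.FreeByCyclic) :
    ∃ (l : ℤ) (x : relChain f.base H), basisVec e γ = place b (f.t ^ l) (x : Chain₁ f.base) := by
  obtain ⟨l, g, rfl⟩ := exists_eq_t_zpow_mul_incl γ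
  refine ⟨l, projRel f.base H (Finsupp.single ((b.edge e).act g) 1), ?_⟩
  rw [place_projRel, place_act_edge]

/-- Makes the approximation lemma `exists_place_mem` available for arbitrary vectors. -/
theorem inducedL2_top : f.inducedL2 b (⊤ : Submodule ℚ (relChain f.base H)) = ⊤ := by
  refine eq_top_iff.2 fun ξ _ => ?_
  refine L2n.induction (p := fun ξ => ξ ∈ f.inducedL2 b ⊤) (isClosed_inducedL2 b _)
    (fun _ _ => add_mem) (zero_mem _) (fun c e γ => Submodule.smul_mem _ _ ?_) ξ
  obtain ⟨l, x, h⟩ := basisVec_eq_place b e γ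
  rw [h]
  exact place_mem_inducedL2 b l trivial

/-- The right multiplication that maps the basis element at `e` to `y e` maps `L²(G_φ)^{n_H}` into
the subspace induced by a submodule that contains all `y e`. -/
theorem rightMulMatrix_mem_inducedL2 {W : Submodule ℚ (relChain f.base H)} (hW : IsPi1Stable W)
    {y : H.CoEdge → relChain f.base H} (hy : ∀ e, y e ∈ W) (ξ : L2n H.CoEdge f.FreeByCyclic) :
    rightMulMatrix (chainMatrix b 1 fun e => (y e : Chain₁ f.base)) ξ ∈ f.inducedL2 b W := by
  refine L2n.map_mem _ (isClosed_inducedL2 b W) (fun e γ => ?_) ξ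
  rw [rightMulMatrix_chainMatrix, mul_one]
  obtain ⟨l, g, rfl⟩ := exists_eq_t_zpow_mul_incl γ
  rw [← place_chainAct]
  have h := place_mem_inducedL2 b l (hW g _ (hy e))
  exact h

/-- Decomposing the finitely many basis elements gives two matrices over the group ring with sum the
identity. The corresponding right multiplications are bounded, so they split every vector, and no
closedness of a sum of subspaces is needed. -/
theorem exists_add_of_sup_eq_top {W W' : Submodule ℚ (relChain f.base H)} (hW : IsPi1Stable W)
    (hW' : IsPi1Stable W') (h : W ⊔ W' = ⊤) (ξ : L2n H.CoEdge f.FreeByCyclic) :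
    ∃ η ∈ f.inducedL2 b W, ∃ η' ∈ f.inducedL2 b W', η + η' = ξ := by
  have hdec : ∀ e : H.CoEdge, ∃ y ∈ W, ∃ y' ∈ W',
      y + y' = projRel f.base H (Finsupp.single (b.edge e) 1) :=
    fun e => Submodule.mem_sup.1 (h ▸ Submodule.mem_top)
  choose y hy y' hy' hadd using hdec
  refine ⟨_, rightMulMatrix_mem_inducedL2 b hW hy ξ, _,
    rightMulMatrix_mem_inducedL2 b hW' hy' ξ, ?_⟩
  refine DFunLike.congr_fun (L2n.map_ext (B := rightMulMatrix (chainMatrix b 1 fun e =>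
    (y e : Chain₁ f.base)) + rightMulMatrix (chainMatrix b 1 fun e => (y' e : Chain₁ f.base)))
    (B' := ContinuousLinearMap.id ℂ _) fun e γ => ?_) ξ
  rw [add_apply, rightMulMatrix_chainMatrix, rightMulMatrix_chainMatrix,
    mul_one, ← place_add, ContinuousLinearMap.id_apply, ← place_edge b γ e,
    ← place_projRel b γ (Finsupp.single _ _), ← hadd]
  rfl

/-- The real part of the component at the coset `t^l 𝔽`. -/
def cosetRealPart (l : ℤ) :
    L2n H.CoEdge f.FreeByCyclic →+ L2n H.CoEdge f.FreeByCyclic :=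
  realPart {γ | level γ = l}

theorem cosetRealPart_apply {l : ℤ} {γ : f.FreeByCyclic} (h : level γ = l)
    (ξ : L2n H.CoEdge f.FreeByCyclic) (e : H.CoEdge) :
    cosetRealPart l ξ e γ = ((ξ e γ).re : ℂ) :=
  realPart_apply_of_mem (S := {γ | level γ = l}) h ξ e

theorem cosetRealPart_apply_of_ne {l : ℤ} {γ : f.FreeByCyclic} (h : level γ ≠ l)
    (ξ : L2n H.CoEdge f.FreeByCyclic) (e : H.CoEdge) : cosetRealPart l ξ e γ = 0 :=
  realPart_apply_of_notMem (S := {γ | level γ = l}) h ξ e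

theorem cosetRealPart_smul_place (l : ℤ) (c : ℂ) (x : Chain₁ f.base) :
    cosetRealPart l (c • place b (f.t ^ l) x) = (c.re : ℂ) • place b (f.t ^ l) x := by
  refine L2n.ext fun e γ => ?_
  have happ : ∀ c : ℂ, (c • place b (f.t ^ l) x) e γ = c * place b (f.t ^ l) x e γ := fun _ => rfl
  rw [happ]
  obtain ⟨k, g, rfl⟩ := exists_eq_t_zpow_mul_incl γ
  by_cases h : k = l
  · subst h
    rw [cosetRealPart_apply (level_t_zpow_mul_incl _ _), happ, place_apply_apply,
      ← Complex.ofReal_ratCast, Complex.re_mul_ofReal, Complex.ofReal_mul]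
  · rw [cosetRealPart_apply_of_ne, place_apply_of_notMem, mul_zero]
    · intro g' h'
      have := congrArg level h'
      rw [level_t_zpow_mul_incl, level_t_zpow_mul_incl] at this
      exact h this.symm
    · exact fun h' => h ((level_t_zpow_mul_incl _ _).symm.trans h')

theorem cosetRealPart_smul_place_of_ne {l k : ℤ} (h : k ≠ l) (c : ℂ) (x : Chain₁ f.base) :
    cosetRealPart l (c • place b (f.t ^ k) x) = 0 := by
  refine L2n.ext fun e γ => ?_
  by_cases hγ : level γ = l
  · rw [cosetRealPart_apply hγ]
    change ((c * place b (f.t ^ k) x e γ).re : ℂ) = 0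
    rw [place_apply_of_notMem, mul_zero, Complex.zero_re, Complex.ofReal_zero]
    rintro g rfl
    exact h ((level_t_zpow_mul_incl _ _).symm.trans hγ)
  · exact cosetRealPart_apply_of_ne hγ _ _

/-- The scalars `1` and `i` recover real and imaginary parts. -/
theorem eq_zero_of_cosetRealPart {ξ : L2n H.CoEdge f.FreeByCyclic}
    (h : ∀ (c : ℂ) (l : ℤ), cosetRealPart l (c • ξ) = 0) : ξ = 0 := by
  have hre : ∀ (c : ℂ) e γ, (c * ξ e γ).re = 0 := by
    intro c e γ
    have h' : cosetRealPart (level γ) (c • ξ) e γ = 0 := by rw [h]; rfl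
    rw [cosetRealPart_apply rfl] at h'
    exact Complex.ofReal_eq_zero.1 h'
  refine L2n.ext fun e γ => Complex.ext ?_ ?_
  · simpa using hre 1 e γ
  · simpa using hre Complex.I e γ

variable {b}

/-- The operator has rational coefficients and moves the coset `t^l 𝔽` to `t^(l+1) 𝔽`. The real part
is only additive, hence the check on complex multiples of basis vectors. -/
theorem cosetRealPart_L (hH : H.Invariant f.toCellularMap) (l : ℤ)
    (ξ : L2n H.CoEdge f.FreeByCyclic) :
    cosetRealPart (l + 1) (f.L b ξ) = f.L b (cosetRealPart l ξ) := by
  refine L2n.induction (p := fun ξ => cosetRealPart (l + 1) (f.L b ξ) =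
    f.L b (cosetRealPart l ξ)) ?_ ?_ ?_ (fun c e γ => ?_) ξ
  · exact isClosed_eq ((continuous_realPart _).comp (f.L b).continuous)
      ((f.L b).continuous.comp (continuous_realPart _))
  · intro ξ η hξ hη
    rw [map_add, map_add, hξ, hη, map_add, map_add]
  · simp
  · obtain ⟨k, x, h⟩ := basisVec_eq_place b e γ
    rw [h, map_smul, L_place_rel hH, ← zpow_add_one]
    by_cases hk : k = l
    · subst hk
      rw [cosetRealPart_smul_place, cosetRealPart_smul_place, map_smul, L_place_rel hH,
        ← zpow_add_one]
    · rw [cosetRealPart_smul_place_of_ne b hk, map_zero,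
        cosetRealPart_smul_place_of_ne b (fun h => hk (add_right_cancel h))]

theorem cosetRealPart_L_pow (hH : H.Invariant f.toCellularMap) (l : ℤ) (j : ℕ)
    (ξ : L2n H.CoEdge f.FreeByCyclic) :
    cosetRealPart (l + j) ((f.L b ^ j) ξ) = (f.L b ^ j) (cosetRealPart l ξ) := by
  induction j with
  | zero => simp
  | succ j ih =>
    rw [pow_succ', mul_apply_eq_comp, mul_apply_eq_comp, ← ih, Nat.cast_succ,
      ← add_assoc, cosetRealPart_L hH]

variable (b)

/-- The translates by `γ` of the chains in `W`. -/
def placeGroup (γ : f.FreeByCyclic) (W : Submodule ℚ (relChain f.base H)) :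
    AddSubgroup (L2n H.CoEdge f.FreeByCyclic) :=
  W.toAddSubgroup.map ((placeHom b γ).comp (relChain f.base H).subtype.toAddMonoidHom)

/-- Density of `ℚ` in `ℝ`. Complex multiples would not do, which is why real parts are taken. -/
theorem smul_place_mem_closure (γ : f.FreeByCyclic) {W : Submodule ℚ (relChain f.base H)} (c : ℝ)
    {x : relChain f.base H} (hx : x ∈ W) :
    (c : ℂ) • place b γ (x : Chain₁ f.base) ∈ (placeGroup b γ W).topologicalClosure := by
  refine map_mem_closure (s := Set.range ((↑) : ℚ → ℝ))
    (f := fun c : ℝ => (c : ℂ) • place b γ (x : Chain₁ f.base))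
    (Complex.continuous_ofReal.smul continuous_const) (Rat.denseRange_cast c) ?_
  rintro _ ⟨q, rfl⟩
  refine ⟨q • x, W.smul_mem q hx, ?_⟩
  change place b γ (q • (x : Chain₁ f.base)) = _
  rw [place_smul]
  simp

theorem cosetRealPart_mem_closure {W : Submodule ℚ (relChain f.base H)} (l : ℤ)
    {ξ : L2n H.CoEdge f.FreeByCyclic} (hξ : ξ ∈ f.inducedL2 b W) :
    cosetRealPart l ξ ∈ (placeGroup b (f.t ^ l) W).topologicalClosure := by
  let K := (placeGroup b (f.t ^ l) W).topologicalClosure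
  -- Quantifying over all multiples `c • ξ` makes the condition complex linear, so that it can be
  -- tested on generators.
  let S : Submodule ℂ (L2n H.CoEdge f.FreeByCyclic) :=
    { carrier := {ξ | ∀ c : ℂ, cosetRealPart l (c • ξ) ∈ K}
      zero_mem' := fun c => by
        rw [smul_zero, map_zero]
        exact zero_mem K
      add_mem' := fun hξ hη c => by
        rw [smul_add, map_add]
        exact add_mem (hξ c) (hη c)
      smul_mem' := fun c ξ hξ c' => by
        rw [smul_smul]
        exact hξ _ }
  have hS : IsClosed (S : Set (L2n H.CoEdge f.FreeByCyclic)) := by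
    have : (S : Set (L2n H.CoEdge f.FreeByCyclic)) =
        ⋂ c : ℂ, (fun ξ => cosetRealPart l (c • ξ)) ⁻¹' (K : Set _) := by
      ext ξ
      simp [S]
    rw [this]
    exact isClosed_iInter fun c => (AddSubgroup.isClosed_topologicalClosure _).preimage
      ((continuous_realPart _).comp (continuous_const_smul c))
  have hle : f.inducedL2 b W ≤ S := by
    refine inducedL2_le b hS fun k x hx c => ?_
    by_cases hk : k = l
    · subst hk
      rw [cosetRealPart_smul_place]
      exact smul_place_mem_closure b _ _ hx
    · rw [cosetRealPart_smul_place_of_ne b hk]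
      exact zero_mem K
  have h := hle hξ 1
  rwa [one_smul] at h

/-- An open neighbourhood of the real part of the component at `t^l 𝔽` contains a translate of a
chain. -/
theorem exists_place_mem {W : Submodule ℚ (relChain f.base H)} (l : ℤ)
    {ξ : L2n H.CoEdge f.FreeByCyclic} (hξ : ξ ∈ f.inducedL2 b W)
    {U : Set (L2n H.CoEdge f.FreeByCyclic)} (hU : IsOpen U) (h : cosetRealPart l ξ ∈ U) :
    ∃ x ∈ W, place b (f.t ^ l) (x : Chain₁ f.base) ∈ U := by
  obtain ⟨_, hy, x, hx, rfl⟩ := mem_closure_iff.1 (cosetRealPart_mem_closure b l hξ) U hU h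
  exact ⟨x, hx, hy⟩

end BasedHomotopyEquiv

/-! ### The two inclusions. -/

namespace BasedHomotopyEquiv

open scoped lp

variable {V : Type u} [Quiver.{v} V] {f : BasedHomotopyEquiv V} {H : Subgraph V}

theorem ARel_pow_relAct_fixed (hH : H.Invariant f.toCellularMap) {ρ : relChain f.base H}
    (hρ : f.IsFixedSegment H ρ) (j : ℕ) (g : Pi1 f.base) :
    (f.ARel H ^ j) (relAct H g ρ) = relAct H ((f.Phi ^ j) g) ρ := by
  induction j generalizing g with
  | zero => rfl
  | succ j ih =>
    rw [pow_succ, Module.End.mul_apply, ARel_relAct, ARel_fixedSegment hH hρ, ih, pow_succ]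
    rfl

/-- A flaring chain that grows slowly does not grow at the first step. -/
theorem chainNorm_ARel_lt {N : Set (relChain f.base H)} {lam : ℝ} (hlam : 1 < lam)
    (hflare : ∀ x ∈ f.saturate H N, lam * chainNorm (f.ARel H x : Chain₁ f.base) ≤
      max (chainNorm (f.ARel H (f.ARel H x) : Chain₁ f.base)) (chainNorm (x : Chain₁ f.base)))
    {x : relChain f.base H} (hx : x ∈ N) (h₀ : 0 < chainNorm (x : Chain₁ f.base)) {j : ℕ}
    (hj : lam * chainNorm ((f.ARel H ^ (j + 1)) x : Chain₁ f.base) <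
      lam ^ (j + 1) * chainNorm (x : Chain₁ f.base)) :
    chainNorm (f.ARel H x : Chain₁ f.base) < chainNorm (x : Chain₁ f.base) := by
  by_contra! hle
  have h := (growth_of_flare (a := fun k => chainNorm ((f.ARel H ^ k) x : Chain₁ f.base)) hlam
    (J := j + 1) (fun k _ => ?_) h₀ hle j le_rfl).2
  · simp only [pow_zero, Module.End.one_apply] at h
    rw [pow_succ' lam, mul_assoc] at hj
    exact (lt_of_mul_lt_mul_left hj (zero_le_one.trans hlam.le)).not_ge h
  -- The forward orbit of `x` consists of images of `N`, so it flares throughout.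
  · have := hflare _ ⟨k, Or.inl ⟨x, hx, rfl⟩⟩
    rw [← Module.End.mul_apply, ← Module.End.mul_apply, ← pow_succ', ← pow_succ'] at this
    exact this

/-- A flaring chain with a slowly growing backward orbit grows at the first step. -/
theorem le_chainNorm_ARel {N : Set (relChain f.base H)} {lam : ℝ} (hlam : 1 < lam)
    (hflare : ∀ x ∈ f.saturate H N, lam * chainNorm (f.ARel H x : Chain₁ f.base) ≤
      max (chainNorm (f.ARel H (f.ARel H x) : Chain₁ f.base)) (chainNorm (x : Chain₁ f.base)))
    {y : relChain f.base H} {j : ℕ} (hy : (f.ARel H ^ (j + 1)) y ∈ N)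
    (h₀ : 0 < chainNorm ((f.ARel H ^ (j + 1)) y : Chain₁ f.base))
    (hj : lam * chainNorm (y : Chain₁ f.base) <
      lam ^ (j + 1) * chainNorm ((f.ARel H ^ (j + 1)) y : Chain₁ f.base)) :
    lam * chainNorm ((f.ARel H ^ (j + 1)) y : Chain₁ f.base) ≤
      chainNorm (f.ARel H ((f.ARel H ^ (j + 1)) y) : Chain₁ f.base) := by
  have hsat : ∀ k ≤ j, lam * chainNorm ((f.ARel H ^ (k + 1)) y : Chain₁ f.base) ≤
      max (chainNorm ((f.ARel H ^ (k + 2)) y : Chain₁ f.base))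
        (chainNorm ((f.ARel H ^ k) y : Chain₁ f.base)) := by
    intro k hk
    -- The points before time `j + 1` are preimages of `N`.
    have := hflare ((f.ARel H ^ k) y) ⟨j + 1 - k, Or.inr (by
      rwa [← Module.End.mul_apply, ← pow_add, Nat.sub_add_cancel (by omega)])⟩
    rw [← Module.End.mul_apply, ← Module.End.mul_apply, ← pow_succ', ← pow_succ'] at this
    exact this
  have hlt : chainNorm ((f.ARel H ^ j) y : Chain₁ f.base) <
      chainNorm ((f.ARel H ^ (j + 1)) y : Chain₁ f.base) := by
    by_contra! hle
    -- The flare inequality is symmetric in time, so the growth lemma applies to the reversed orbit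
    -- and would make `y` too large.
    have h := (growth_of_flare
      (a := fun k => chainNorm ((f.ARel H ^ (j + 1 - k)) y : Chain₁ f.base)) hlam
      (J := j + 1) (fun k hk => ?_) h₀ hle j le_rfl).2
    · simp only [Nat.sub_self, Nat.sub_zero, pow_zero, Module.End.one_apply] at h
      rw [pow_succ' lam, mul_assoc] at hj
      exact (lt_of_mul_lt_mul_left hj (zero_le_one.trans hlam.le)).not_ge h
    · obtain ⟨m, hm⟩ := Nat.exists_eq_add_of_le hk
      have := hsat m (by omega)
      rw [max_comm, show j + 1 - k = m + 2 by omega,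
        show j + 1 - (k + 1) = m + 1 by omega, show j + 1 - (k + 2) = m by omega]
      exact this
  have h := hsat j le_rfl
  rw [pow_succ' _ (j + 1), Module.End.mul_apply] at h
  rcases le_max_iff.1 h with h | h
  · exact h
  · nlinarith

variable [Finite (Quiver.Total V)] {b : f.EdgeLifts H}

theorem norm_place_relAct_sum_le (γ : f.FreeByCyclic) (q : Pi1 f.base →₀ ℚ)
    (σ : Pi1 f.base → Pi1 f.base) (ρ : relChain f.base H) :
    ‖place b γ ((q.sum fun g c => c • relAct H (σ g) ρ : relChain f.base H) : Chain₁ f.base)‖ ≤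
      q.sum fun _ c => |(c : ℝ)| * chainNorm (ρ : Chain₁ f.base) := by
  rw [Finsupp.sum, Finsupp.sum, AddSubmonoidClass.coe_finsetSum, place_sum]
  refine (norm_sum_le _ _).trans (Finset.sum_le_sum fun g _ => le_of_eq ?_)
  change ‖place b γ (q g • chainAct (σ g) (ρ : Chain₁ f.base))‖ = _
  rw [place_smul, place_chainAct, norm_smul, norm_place, ← Complex.ofReal_ratCast,
    Complex.norm_real, Real.norm_eq_abs]

/-- Powers of `A` permute the translates of `ρ`, so a combination of translates keeps its
coefficients and the bound `∑ |q_g| ‖ρ‖`. -/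
theorem inducedL2_subset (hH : H.Invariant f.toCellularMap) {Vqf : Submodule ℚ (relChain f.base H)}
    (hgen : Vqf ≠ ⊥ → ∃ ρ : relChain f.base H, f.IsNielsen H ρ ∧
      ∀ x ∈ Vqf, ∃ q : Pi1 f.base →₀ ℚ, x = q.sum fun g c => c • relAct H g ρ)
    {ν : ℝ} (hν : 1 ≤ ν) :
    (f.inducedL2 b Vqf : Set (L2n H.CoEdge f.FreeByCyclic)) ⊆
      hsE (f.L b) ν ∩ hsF (f.L b) ν⁻¹ := by
  have hν₀ : 0 < ν := one_pos.trans_le hν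
  rw [hsE_eq_hsSet, hsF_inv_eq_hsSet]
  have key : ∀ (l : ℤ), ∀ x ∈ Vqf, ∃ C : ℝ,
      (∀ j : ℕ, ‖(f.L b ^ j) (place b (f.t ^ l) (x : Chain₁ f.base))‖ ≤ C) ∧
      ∀ j : ℕ, ∃ η, (f.L b ^ j) η = place b (f.t ^ l) (x : Chain₁ f.base) ∧ ‖η‖ ≤ C := by
    intro l x hx
    by_cases hbot : Vqf = ⊥
    · rw [hbot, Submodule.mem_bot] at hx
      subst hx
      exact ⟨0, fun j => by simp [place_zero], fun j => ⟨0, by simp [place_zero]⟩⟩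
    obtain ⟨ρ, ⟨hρ, -⟩, hq⟩ := hgen hbot
    obtain ⟨q, rfl⟩ := hq x hx
    have hpow : ∀ (j : ℕ) (σ : Pi1 f.base → Pi1 f.base),
        (f.ARel H ^ j) (q.sum fun g c => c • relAct H (σ g) ρ) =
          q.sum fun g c => c • relAct H ((f.Phi ^ j) (σ g)) ρ := by
      intro j σ
      rw [Finsupp.sum, Finsupp.sum, map_sum]
      refine Finset.sum_congr rfl fun g _ => ?_
      rw [map_smul, ARel_pow_relAct_fixed hH hρ]
    refine ⟨q.sum fun _ c => |(c : ℝ)| * chainNorm (ρ : Chain₁ f.base), fun j => ?_, fun j => ?_⟩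
    · rw [L_pow_place_rel hH, hpow j fun g => g]
      exact norm_place_relAct_sum_le _ q _ ρ
    -- An exact preimage under the `j`-th power: `Φ^j` is undone on the translating elements, and
    -- the coset is moved back by `j`.
    · refine ⟨place b (f.t ^ (l - j)) ((q.sum fun g c =>
        c • relAct H ((f.Phi ^ j)⁻¹ g) ρ : relChain f.base H) : Chain₁ f.base), ?_,
        norm_place_relAct_sum_le _ q _ ρ⟩
      rw [L_pow_place_rel hH, hpow j, ← zpow_natCast, ← zpow_add, sub_add_cancel]
      simp only [MulAut.apply_inv_self]
  refine Set.subset_inter ?_ ?_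
  · refine inducedL2_le b (isClosed_hsSubmodule (U := fun _ => 1) (W := (f.L b ^ ·)) hν₀)
      fun l x hx => ?_
    obtain ⟨C, hC, -⟩ := key l x hx
    exact mem_hsSet_of_bounded hν C fun j => ⟨_, rfl, hC j⟩
  · refine inducedL2_le b (isClosed_hsSubmodule (U := (f.L b ^ ·)) (W := fun _ => 1) hν₀)
      fun l x hx => ?_
    obtain ⟨C, -, hC⟩ := key l x hx
    exact mem_hsSet_of_bounded hν C hC

/-- A nonzero real part could be approximated both by chains that shrink under `A` and by chains
that expand by the factor `lam`. -/
theorem cosetRealPart_eq_zero (hH : H.Invariant f.toCellularMap)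
    {W : Submodule ℚ (relChain f.base H)} {lam θ : ℝ} (hlam : 1 < lam) (hθ : θ < 1)
    (hflare : ∀ x ∈ f.saturate H (angleNhd θ W), lam * chainNorm (f.ARel H x : Chain₁ f.base) ≤
      max (chainNorm (f.ARel H (f.ARel H x) : Chain₁ f.base)) (chainNorm (x : Chain₁ f.base)))
    {ν : ℝ} (hν : 1 ≤ ν) (hνlam : ν < lam) {ξ : L2n H.CoEdge f.FreeByCyclic}
    (hξ : ξ ∈ f.inducedL2 b W) (hE : ξ ∈ hsE (f.L b) ν) (hF : ξ ∈ hsF (f.L b) ν⁻¹) (l : ℤ) :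
    cosetRealPart l ξ = 0 := by
  by_contra hne
  set ω := cosetRealPart l ξ with hω
  have hr : 0 < ‖ω‖ := norm_pos_iff.2 hne
  have hν₀ : 0 ≤ ν := zero_le_one.trans hν
  have htop : ∀ η : L2n H.CoEdge f.FreeByCyclic,
      η ∈ f.inducedL2 b (⊤ : Submodule ℚ (relChain f.base H)) := fun η => by
    rw [inducedL2_top]
    trivial
  obtain ⟨μ, hμ, hμlam⟩ := exists_between hνlam
  -- The first and last bounds make chains within `ε` of `ω` lie at small angle to `W`; the middle
  -- one is the final contradiction.
  obtain ⟨ε, hε, hεθ, hεL⟩ : ∃ ε : ℝ, 0 < ε ∧ ε ≤ (1 - θ) * ‖ω‖ / 4 ∧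
      (1 + lam + 2 * ‖f.L b‖) * ε < (lam - 1) * ‖ω‖ ∧ ε ≤ ‖ω‖ / 4 := by
    have hK : 0 < 1 + lam + 2 * ‖f.L b‖ := by positivity
    have h₁ : 0 < (1 - θ) * ‖ω‖ / 4 := by
      have := sub_pos.2 hθ
      positivity
    have h₂ : 0 < (lam - 1) * ‖ω‖ / (1 + lam + 2 * ‖f.L b‖) / 2 := by
      have := sub_pos.2 hlam
      positivity
    refine ⟨min (min ((1 - θ) * ‖ω‖ / 4) (‖ω‖ / 4))
      ((lam - 1) * ‖ω‖ / (1 + lam + 2 * ‖f.L b‖) / 2), ?_, ?_, ?_, ?_⟩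
    · exact lt_min (lt_min h₁ (by positivity)) h₂
    · exact (min_le_left _ _).trans (min_le_left _ _)
    · rw [mul_comm, ← lt_div_iff₀ hK]
      exact (min_le_right _ _).trans_lt (half_lt_self (by linarith))
    · exact (min_le_left _ _).trans (min_le_right _ _)
  obtain ⟨hεL, hεr⟩ := hεL
  have hnear : ∀ {x : relChain f.base H}, ‖place b (f.t ^ l) (x : Chain₁ f.base) - ω‖ < ε →
      ‖ω‖ - ε < chainNorm (x : Chain₁ f.base) ∧ chainNorm (x : Chain₁ f.base) < ‖ω‖ + ε := by
    intro x hx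
    rw [← norm_place b (f.t ^ l) x]
    have h₁ := norm_sub_norm_le (place b (f.t ^ l) (x : Chain₁ f.base)) ω
    have h₂ := norm_sub_norm_le ω (place b (f.t ^ l) (x : Chain₁ f.base))
    rw [norm_sub_rev] at h₂
    constructor <;> linarith
  have hball : IsOpen {η : L2n H.CoEdge f.FreeByCyclic | ‖η - ω‖ < ε} :=
    isOpen_lt (by fun_prop) continuous_const
  obtain ⟨v, hv, hvω⟩ := exists_place_mem b l hξ hball (by simpa [← hω] using hε)
  have hangle : ∀ x : relChain f.base H, ‖place b (f.t ^ l) (x : Chain₁ f.base) - ω‖ < ε →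
      x ∈ angleNhd θ W := by
    intro x hx
    refine mem_angleNhd hv ?_
    have h₁ : chainNorm ((v : Chain₁ f.base) - (x : Chain₁ f.base)) < 2 * ε := by
      have h := norm_place b (f.t ^ l) (v - x)
      rw [Submodule.coe_sub, place_sub] at h
      rw [← h]
      have := norm_sub_le_norm_sub_add_norm_sub (place b (f.t ^ l) (v : Chain₁ f.base)) ω
        (place b (f.t ^ l) (x : Chain₁ f.base))
      rw [norm_sub_rev ω] at this
      exact this.trans_lt (by linarith [show ‖place b (f.t ^ l) (v : Chain₁ f.base) - ω‖ < ε from hvω])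
    have h₂ : ‖ω‖ / 2 * (‖ω‖ / 2) ≤
        chainNorm (v : Chain₁ f.base) * chainNorm (x : Chain₁ f.base) :=
      mul_le_mul (by linarith [(hnear hvω).1]) (by linarith [(hnear hx).1]) (by positivity)
        (Real.sqrt_nonneg _)
    have h₃ : chainNorm ((v : Chain₁ f.base) - (x : Chain₁ f.base)) ^ 2 < (2 * ε) ^ 2 :=
      pow_lt_pow_left₀ h₁ (Real.sqrt_nonneg _) two_ne_zero
    -- The right side is `(1 - θ)‖ω‖²/4`, half of the lower bound that `h₂` gives for `2(1 -
    -- θ)‖v‖‖x‖`.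
    have h₄ : (2 * ε) ^ 2 ≤ 4 * ((1 - θ) * ‖ω‖ / 4 * (‖ω‖ / 4)) := by
      rw [mul_pow, sq ε]
      norm_num
      exact mul_le_mul hεθ hεr hε.le (hε.le.trans hεθ)
    have h₅ := mul_le_mul_of_nonneg_left h₂ (sub_pos.2 hθ).le
    nlinarith [mul_nonneg (sub_pos.2 hθ).le (sq_nonneg ‖ω‖)]
  have hforward : ∀ᶠ j in atTop, ∃ z : relChain f.base H,
      ‖place b (f.t ^ l) (z : Chain₁ f.base) - ω‖ < ε ∧
        chainNorm ((f.ARel H ^ j) z : Chain₁ f.base) < μ ^ j := by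
    rw [hsE_eq_hsSet, mem_hsSet_iff hν₀] at hE
    filter_upwards [hE μ hμ ε hε] with j ⟨η, h₁, h₂⟩
    -- Being near `ω` and having a small `j`-th image are both open conditions, so a single rational
    -- chain meets both.
    obtain ⟨z, -, hz₁, hz₂⟩ := exists_place_mem b l (htop η)
      (U := {η | ‖η - ω‖ < ε} ∩ {η | ‖(f.L b ^ j) η‖ < μ ^ j})
      (hball.inter (isOpen_lt (by fun_prop) continuous_const)) ⟨by
        change ‖_ - _‖ < ε
        rw [hω, ← map_sub]
        exact (norm_realPart_le _ _).trans_lt h₁, by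
        change ‖_‖ < _
        rw [← cosetRealPart_L_pow hH]
        exact (norm_realPart_le _ _).trans_lt h₂⟩
    refine ⟨z, hz₁, ?_⟩
    change ‖_‖ < _ at hz₂
    rwa [L_pow_place_rel hH, norm_place] at hz₂
  have hbackward : ∀ᶠ j : ℕ in atTop, ∃ y : relChain f.base H,
      ‖place b (f.t ^ l) ((f.ARel H ^ j) y : Chain₁ f.base) - ω‖ < ε ∧
        chainNorm (y : Chain₁ f.base) < μ ^ j := by
    rw [hsF_inv_eq_hsSet, mem_hsSet_iff hν₀] at hF
    filter_upwards [hF μ hμ ε hε] with j ⟨η, h₁, h₂⟩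
    -- The preimage is sought on the coset `l - j`, which `j` steps carry to `l`.
    obtain ⟨y, -, hy₁, hy₂⟩ := exists_place_mem b (l - j) (htop η)
      (U := {η | ‖(f.L b ^ j) η - ω‖ < ε} ∩ {η | ‖η‖ < μ ^ j})
      ((isOpen_lt (by fun_prop) continuous_const).inter
        (isOpen_lt continuous_norm continuous_const)) ⟨by
        change ‖_ - _‖ < ε
        rw [← cosetRealPart_L_pow hH, sub_add_cancel, hω, ← map_sub]
        exact (norm_realPart_le _ _).trans_lt h₁, (norm_realPart_le _ _).trans_lt h₂⟩
    refine ⟨y, ?_, ?_⟩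
    · change ‖_ - _‖ < ε at hy₁
      rwa [L_pow_place_rel hH, ← zpow_natCast, ← zpow_add, sub_add_cancel] at hy₁
    · change ‖_‖ < _ at hy₂
      rwa [norm_place] at hy₂
  have hμ₀ : 0 < μ := (zero_lt_one.trans_le hν).trans hμ
  -- All conditions are taken at time `j + 1`, as the two flaring lemmas need. The constant comes
  -- from the lower bound `‖ω‖ / 2` for the norm of chains near `ω`.
  obtain ⟨j, ⟨z, hz, hzj⟩, ⟨y, hy, hyj⟩, hj⟩ := ((tendsto_add_atTop_nat 1).eventually
    (hforward.and (hbackward.and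
      (eventually_mul_pow_le (lam / (‖ω‖ / 2)) hμ₀ hμlam)))).exists
  have hlam₀ : 0 < lam := one_pos.trans hlam
  rw [div_mul_eq_mul_div, div_le_iff₀ (by positivity)] at hj
  have hsmall : ∀ {c : ℝ} {x : relChain f.base H}, c < μ ^ (j + 1) →
      ‖place b (f.t ^ l) (x : Chain₁ f.base) - ω‖ < ε →
      lam * c < lam ^ (j + 1) * chainNorm (x : Chain₁ f.base) := by
    intro c x hc hx
    refine (mul_lt_mul_of_pos_left hc hlam₀).trans_le (hj.trans ?_)
    exact mul_le_mul_of_nonneg_left (by linarith [(hnear hx).1]) (by positivity)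
  have h₁ := chainNorm_ARel_lt hlam hflare (hangle z hz) (by linarith [(hnear hz).1])
    (hsmall hzj hz)
  have h₂ := le_chainNorm_ARel hlam hflare (hangle _ hy) (by linarith [(hnear hy).1])
    (hsmall hyj hy)
  set w := (f.ARel H ^ (j + 1)) y
  have h₃ : chainNorm (f.ARel H w : Chain₁ f.base) ≤
      chainNorm (f.ARel H z : Chain₁ f.base) + ‖f.L b‖ * (2 * ε) := by
    rw [← norm_place b (f.t ^ l * f.t), ← norm_place b (f.t ^ l * f.t) (f.ARel H z),
      ← L_place_rel hH, ← L_place_rel hH]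
    refine (norm_le_norm_add_norm_sub' _ (f.L b (place b (f.t ^ l) (z : Chain₁ f.base)))).trans ?_
    gcongr
    rw [← map_sub]
    refine (ContinuousLinearMap.le_opNorm _ _).trans ?_
    gcongr
    have := norm_sub_le_norm_sub_add_norm_sub (place b (f.t ^ l) (w : Chain₁ f.base)) ω
        (place b (f.t ^ l) (z : Chain₁ f.base))
    rw [norm_sub_rev ω] at this
    linarith
  -- Altogether `lam (‖ω‖ - ε) < ‖ω‖ + ε + 2ε‖L‖`, against the choice of `ε`.
  nlinarith [(hnear hz).2, (hnear hy).1]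

/-- The quasi-fixed subspace is cut out by the growth conditions of Haagerup and Schultz. -/
theorem exists_inducedL2_eq (hH : H.Invariant f.toCellularMap)
    {Vh Vqf : Submodule ℚ (relChain f.base H)} (hflare : f.ChainFlareCondition H Vh Vqf) :
    ∃ lam : ℝ, 1 < lam ∧ ∀ ν : ℝ, 1 ≤ ν → ν < lam →
      (f.inducedL2 b Vqf : Set (L2n H.CoEdge f.FreeByCyclic)) =
        hsE (f.L b) ν ∩ hsF (f.L b) ν⁻¹ := by
  obtain ⟨lam, θ, hlam, -, hθ, hfl⟩ := hflare.flare
  refine ⟨lam, hlam, fun ν hν hνlam => ?_⟩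
  have hsub := inducedL2_subset (b := b) hH hflare.generated hν
  refine hsub.antisymm ?_
  rintro ξ ⟨hE, hF⟩
  have hν₀ : 0 < ν := one_pos.trans_le hν
  obtain ⟨η, hη, η', hη', rfl⟩ := exists_add_of_sup_eq_top b hflare.stable_h hflare.stable_qf
    hflare.sup_eq_top ξ
  let SE := hsSubmodule (fun _ => 1) (f.L b ^ ·) hν₀
  let SF := hsSubmodule (f.L b ^ ·) (fun _ => 1) hν₀
  obtain ⟨hE', hF'⟩ := hsub hη'
  rw [hsE_eq_hsSet] at hE hE'
  rw [hsF_inv_eq_hsSet] at hF hF'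
  -- The quasi-fixed summand already lies in both growth subspaces, so the hyperbolic one does too.
  have hηE : η ∈ SE := (SE.add_mem_iff_left hE').1 hE
  have hηF : η ∈ SF := (SF.add_mem_iff_left hF').1 hF
  have h0 : η = 0 := eq_zero_of_cosetRealPart fun c l =>
    cosetRealPart_eq_zero hH hlam hθ hfl hν hνlam (Submodule.smul_mem _ c hη)
      (SE.smul_mem c hηE) (by rw [hsF_inv_eq_hsSet]; exact SF.smul_mem c hηF) l
  rw [h0, zero_add]
  exact hη'

end BasedHomotopyEquiv

end ChainFlare

end

theorem mainTheorem7 {V : Type u} [Quiver.{v} V] [Finite (Quiver.Total V)]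
    (hV : ChainFlare.IsConnectedGraph V)
    (f : ChainFlare.BasedHomotopyEquiv V)
    (H : ChainFlare.Subgraph V) (hH : H.Invariant f.toCellularMap)
    (b : f.EdgeLifts H)
    (Vh Vqf : Submodule ℚ (ChainFlare.relChain f.base H))
    (hflare : f.ChainFlareCondition H Vh Vqf) :
    ∃ lam : ℝ, 1 < lam ∧ ∀ ν : ℝ, 1 ≤ ν → ν < lam →
      (f.inducedL2 b Vqf : Set (ChainFlare.L2n H.CoEdge f.FreeByCyclic)) =
        ChainFlare.hsE (f.L b) ν ∩ ChainFlare.hsF (f.L b) ν⁻¹ :=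
  ChainFlare.BasedHomotopyEquiv.exists_inducedL2_eq hH hflare
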